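/- All Hilbert spaces are complex, operators are bounded and linear, and $q$ is a complex number with $|q|=1$. A *$q$-commuting contractive pair* on $\mathcal H$ is a pair $(T_1,T_2)$ of contractions with $T_1T_2=qT_2T_1$. Put $T=T_1T_2$. **Pseudo $q$-commuting contractive lifts.** Operators $(\mathbb W_1,\mathbb W_2,\mathbb W)$ on a Hilbert space $\mathcal K$ form a *pseudo $q$-commuting contractive triple* if $\mathbb W_1,\mathbb W_2$ are contractions, $\mathbb W$ is an isometry, $\mathbb W_1\mathbb W=q\,\mathbb W\mathbb W_1$, $\mathbb W_2\mathbb W=\bar q\,\mathbb W\mathbb W_2$ and $\mathbb W_1=\bar q\,\mathbb W_2^*\mathbb W$. If moreover $\Pi:\mathcal H\to\mathcal K$ is an isometry with $\Pi T_1^*=\mathbb W_1^*\Pi$, $\Pi T_2^*=\mathbb W_2^*\Pi$, $\Pi T_2^*T_1^*=\mathbb W^*\Pi$ and $\mathcal K=\overline{\operatorname{span}}\{\mathbb W^n\Pi h: n\ge 0,\ h\in\mathcal H\}$, then $(\Pi,\mathbb W_1,\mathbb W_2,\mathbb W)$ is a *pseudo $q$-commuting contractive lift* of $(T_1,T_2,T_1T_2)$.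 **The Douglas model.** Let $(T_1,T_2)$ be a $q$-commuting contractive pair on $\mathcal H$. * $D_{T^*}=(I-TT^*)^{1/2}$ and $\mathcal D_{T^*}=\overline{\operatorname{Ran}}\,D_{T^*}$. On the Hardy space $H^2(\mathcal D_{T^*})$ of the unit disc, $M_\varphi$ denotes multiplication by $\varphi$, and $(R_qf)(z)=f(qz)$, $(R_{\bar q}f)(z)=f(\bar qz)$. For $h\in\mathcal H$, $\mathcal O h=\sum_{n\ge0}z^nD_{T^*}T^{*n}h\in H^2(\mathcal D_{T^*})$. * $Q_{T^*}$ is the positive square root of the strong limit of $T^nT^{*n}$, and $X^*$ is the isometry on $\overline{\operatorname{Ran}}\,Q_{T^*}$ with $X^*Q_{T^*}h=Q_{T^*}T^*h$. $W_D$ is the unitary on $\mathcal Q_{T^*}\supseteq\overline{\operatorname{Ran}}\,Q_{T^*}$ such that $W_D^*$ is the minimal unitary extension of $X^*$; thus $\mathcal Q_{T^*}=\overline{\operatorname{span}}\{W_D^nx: n\ge0,\ x\in\operatorname{Ran}Q_{T^*}\}$. * $(G_1,G_2)$, the fundamental operators of $(T_1^*,T_2^*)$, are the unique operators on $\mathcal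 D_{T^*}$ with $T_1^*-T_2T^*=D_{T^*}G_1D_{T^*}$ and $T_2^*-qT_1T^*=D_{T^*}G_2D_{T^*}$. * $(W_1,W_2)$, the canonical $q$-commuting unitary pair, is the unique $q$-commuting pair of unitaries on $\mathcal Q_{T^*}$ with $W_j^*Q_{T^*}h=Q_{T^*}T_j^*h$ for $j=1,2$ and $h\in\mathcal H$, and $W_1^*W_2^*=qW_D^*$. On $\mathcal K_D=H^2(\mathcal D_{T^*})\oplus\mathcal Q_{T^*}$ put $\Pi_Dh=\mathcal Oh\oplus Q_{T^*}h$ and $$\mathbb W_1^D=\begin{bmatrix}M_{G_1^*+zG_2}R_q&0\\0&W_1\end{bmatrix},\quad \mathbb W_2^D=\begin{bmatrix}R_{\bar q}M_{G_2^*+zG_1}&0\\0&W_2\end{bmatrix},\quad V_D=\begin{bmatrix}M_z&0\\0&W_D\end{bmatrix}.$$ **Statement.** Let $(T_1,T_2)$ be a $q$-commuting contractive pair on $\mathcal H$, and let $(\Pi,\mathbb W_1,\mathbb W_2,\mathbb W)$ be a pseudo $q$-commuting contractive lift of $(T_1,T_2,T_1T_2)$ on $\mathcal K$. Then $(\Pi_D,\mathbb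 W_1^D,\mathbb W_2^D,V_D)$ is a pseudo $q$-commuting contractive lift of $(T_1,T_2,T_1T_2)$, and $(\Pi,\mathbb W_1,\mathbb W_2,\mathbb W)$ is unitarily equivalent to it: there is a unitary $\tau:\mathcal K\to\mathcal K_D$ with $$\tau\Pi=\Pi_D,\qquad \tau\mathbb W_1=\mathbb W_1^D\tau,\qquad \tau\mathbb W_2=\mathbb W_2^D\tau,\qquad \tau\mathbb W=V_D\tau .$$ -/

import Mathlib

open scoped ComplexConjugate ComplexInnerProductSpace

noncomputable section

set_option linter.unusedSectionVars false

namespace QComm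

/-! ### The vector-valued Hardy space -/

/-- The Hardy space `H²(E)` of the unit disc: an element is the sequence `(f₀, f₁, …)` of Taylor
coefficients of `f(z) = ∑ zⁿ fₙ`, with `‖f‖² = ∑ ‖fₙ‖² < ∞`. -/
abbrev Hardy (E : Type*) [NormedAddCommGroup E] : Type _ := lp (fun _ : ℕ => E) 2

section Hardy

variable {E F : Type*} [NormedAddCommGroup E] [InnerProductSpace ℂ E]
  [NormedAddCommGroup F] [InnerProductSpace ℂ F]

theorem Hardy.hasSum_sq (f : Hardy E) : HasSum (fun n => ‖f n‖ ^ 2) (‖f‖ ^ 2) := by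
  simpa using lp.hasSum_norm (p := 2) (by norm_num) f

theorem Hardy.memlp_of_sum_le {f : ℕ → E} (C : ℝ)
    (h : ∀ s : Finset ℕ, ∑ n ∈ s, ‖f n‖ ^ 2 ≤ C) : Memℓp f 2 :=
  memℓp_gen' (C := C) (by simpa using h)

theorem Hardy.norm_le_of_sum_le {f : Hardy E} {C : ℝ} (hC : 0 ≤ C)
    (h : ∀ s : Finset ℕ, ∑ n ∈ s, ‖f n‖ ^ 2 ≤ C ^ 2) : ‖f‖ ≤ C :=
  lp.norm_le_of_forall_sum_le (p := 2) (by norm_num) hC (by simpa using h)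

/-- The function `z ↦ ∑ zⁿ fₙ` on the unit disc given by `f ∈ H²(E)`. -/
def Hardy.eval (f : Hardy E) (z : ℂ) : E := ∑' n, z ^ n • f n

theorem Hardy.sum_map_le (A : E →L[ℂ] F) (f : Hardy E) (s : Finset ℕ) :
    ∑ n ∈ s, ‖A (f n)‖ ^ 2 ≤ (‖A‖ * ‖f‖) ^ 2 := by
  calc ∑ n ∈ s, ‖A (f n)‖ ^ 2 ≤ ∑ n ∈ s, ‖A‖ ^ 2 * ‖f n‖ ^ 2 := by
        refine Finset.sum_le_sum fun n _ => ?_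
        rw [← mul_pow]
        gcongr
        exact A.le_opNorm _
    _ = ‖A‖ ^ 2 * ∑ n ∈ s, ‖f n‖ ^ 2 := by rw [Finset.mul_sum]
    _ ≤ ‖A‖ ^ 2 * ‖f‖ ^ 2 := by
        gcongr
        exact sum_le_hasSum s (fun _ _ => by positivity) (Hardy.hasSum_sq f)
    _ = _ := by ring

/-- The operator `I ⊗ A : H²(E) → H²(F)`, `(I ⊗ A) f (z) = A (f z)`. -/
def hardyMap (A : E →L[ℂ] F) : Hardy E →L[ℂ] Hardy F :=
  LinearMap.mkContinuous
    { toFun := fun f => ⟨fun n => A (f n), Hardy.memlp_of_sum_le _ (Hardy.sum_map_le A f)⟩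
      map_add' := fun f g => lp.ext (funext fun n => A.map_add (f n) (g n))
      map_smul' := fun c f => lp.ext (funext fun n => A.map_smul c (f n)) }
    ‖A‖ (fun f => Hardy.norm_le_of_sum_le (by positivity) (Hardy.sum_map_le A f))

@[simp] theorem hardyMap_apply (A : E →L[ℂ] F) (f : Hardy E) (n : ℕ) :
    hardyMap A f n = A (f n) := rfl

/-- The sequence `(0, f₀, f₁, …)`. -/
def shiftSeq {E : Type*} [Zero E] (f : ℕ → E) : ℕ → E
  | 0 => 0
  | n + 1 => f n

theorem Hardy.hasSum_shift (f : Hardy E) :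
    HasSum (fun n => ‖shiftSeq f n‖ ^ 2) (‖f‖ ^ 2) := by
  have h := (hasSum_nat_add_iff (f := fun n => ‖shiftSeq f n‖ ^ 2) 1
    (g := ‖f‖ ^ 2)).1 (Hardy.hasSum_sq f)
  simpa [shiftSeq] using h

/-- The shift `M_z` on `H²(E)`, `(M_z f)(z) = z f(z)`. -/
def shift (E : Type*) [NormedAddCommGroup E] [InnerProductSpace ℂ E] : Hardy E →L[ℂ] Hardy E :=
  LinearMap.mkContinuous
    { toFun := fun f => ⟨shiftSeq f,
        Hardy.memlp_of_sum_le _ fun s =>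
          sum_le_hasSum s (fun _ _ => by positivity) (Hardy.hasSum_shift f)⟩
      map_add' := fun f g => lp.ext (funext fun n => by
        cases n with
        | zero => exact (add_zero (0 : E)).symm
        | succ n => rfl)
      map_smul' := fun c f => lp.ext (funext fun n => by
        cases n with
        | zero => exact (smul_zero c).symm
        | succ n => rfl) }
    1 (fun f => Hardy.norm_le_of_sum_le (by positivity) fun s => by
      rw [one_mul]
      exact sum_le_hasSum s (fun _ _ => by positivity) (Hardy.hasSum_shift f))

@[simp] theorem shift_apply_zero (f : Hardy E) : shift E f 0 = 0 := rfl

@[simp] theorem shift_apply_succ (f : Hardy E) (n : ℕ) : shift E f (n + 1) = f n := rfl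

theorem Hardy.sum_rotation_le {q : ℂ} (hq : ‖q‖ = 1) (f : Hardy E) (s : Finset ℕ) :
    ∑ n ∈ s, ‖q ^ n • f n‖ ^ 2 ≤ ‖f‖ ^ 2 := by
  simp only [norm_smul, norm_pow, hq, one_pow, one_mul]
  exact sum_le_hasSum s (fun _ _ => by positivity) (Hardy.hasSum_sq f)

/-- The rotation operator `R_q` on `H²(E)`, `(R_q f)(z) = f(q z)`. -/
def rotation (E : Type*) [NormedAddCommGroup E] [InnerProductSpace ℂ E] {q : ℂ} (hq : ‖q‖ = 1) :
    Hardy E →L[ℂ] Hardy E :=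
  LinearMap.mkContinuous
    { toFun := fun f => ⟨fun n => q ^ n • f n,
        Hardy.memlp_of_sum_le _ (Hardy.sum_rotation_le hq f)⟩
      map_add' := fun f g => lp.ext (funext fun n => smul_add (q ^ n) (f n) (g n))
      map_smul' := fun c f => lp.ext (funext fun n => smul_comm (q ^ n) c (f n)) }
    1 (fun f => Hardy.norm_le_of_sum_le (by positivity) (by
      rw [one_mul]; exact Hardy.sum_rotation_le hq f))

@[simp] theorem rotation_apply {q : ℂ} (hq : ‖q‖ = 1) (f : Hardy E) (n : ℕ) :
    rotation E hq f n = q ^ n • f n := rfl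

/-- The multiplication operator `M_{A + z B}` on `H²(E)`, `(M_{A + z B} f)(z) = (A + z B) f(z)`. -/
def mulPencil (A B : E →L[ℂ] E) : Hardy E →L[ℂ] Hardy E :=
  hardyMap A + shift E ∘L hardyMap B

theorem Hardy.summable_eval [CompleteSpace E] (f : Hardy E) {z : ℂ} (hz : ‖z‖ < 1) :
    Summable fun n => z ^ n • f n := by
  refine Summable.of_norm_bounded (g := fun n => ‖z‖ ^ n * ‖f‖)
    ((summable_geometric_of_lt_one (norm_nonneg _) hz).mul_right _) fun n => ?_
  rw [norm_smul, norm_pow]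
  gcongr
  exact lp.norm_apply_le_norm (by norm_num) f n

theorem shift_eval [CompleteSpace E] (f : Hardy E) {z : ℂ} (hz : ‖z‖ < 1) :
    (shift E f).eval z = z • f.eval z := by
  rw [Hardy.eval, (Hardy.summable_eval (shift E f) hz).tsum_eq_zero_add, Hardy.eval,
    ← tsum_const_smul'']
  simp only [shift_apply_zero, shift_apply_succ, smul_zero, zero_add, pow_succ', mul_smul]

theorem rotation_eval {q : ℂ} (hq : ‖q‖ = 1) (f : Hardy E) (z : ℂ) :
    (rotation E hq f).eval z = f.eval (q * z) := by
  simp only [Hardy.eval, rotation_apply, mul_pow, mul_smul]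
  exact tsum_congr fun n => smul_comm _ _ _

theorem mulPencil_eval [CompleteSpace E] (A B : E →L[ℂ] E) (f : Hardy E) {z : ℂ}
    (hz : ‖z‖ < 1) : (mulPencil A B f).eval z = (A + z • B) (f.eval z) := by
  have hm : ∀ C : E →L[ℂ] E, (hardyMap C f).eval z = C (f.eval z) := fun C => by
    rw [Hardy.eval, Hardy.eval, C.map_tsum (Hardy.summable_eval f hz)]
    simp
  have ha : (mulPencil A B f).eval z
      = (hardyMap A f).eval z + (shift E (hardyMap B f)).eval z := by
    rw [Hardy.eval, Hardy.eval, Hardy.eval,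
      ← (Hardy.summable_eval _ hz).tsum_add (Hardy.summable_eval _ hz)]
    exact tsum_congr fun n => by simp [mulPencil]
  rw [ha, hm, shift_eval _ hz, hm]
  simp

end Hardy

/-- The block-diagonal operator `A ⊕ B` on the Hilbert space direct sum `E ⊕ F`. -/
def blockDiag {E F : Type*} [NormedAddCommGroup E] [InnerProductSpace ℂ E]
    [NormedAddCommGroup F] [InnerProductSpace ℂ F] (A : E →L[ℂ] E) (B : F →L[ℂ] F) :
    WithLp 2 (E × F) →L[ℂ] WithLp 2 (E × F) :=
  (WithLp.prodContinuousLinearEquiv 2 ℂ E F).symm.toContinuousLinearMap ∘L (A.prodMap B) ∘L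
    (WithLp.prodContinuousLinearEquiv 2 ℂ E F).toContinuousLinearMap

/-! ### The minimal unitary extension of an isometry -/

section MinimalUnitaryExtension

variable {E : Type*} [NormedAddCommGroup E] [InnerProductSpace ℂ E] [CompleteSpace E]

/-- The space `E ⊕ H²((ran V)ᗮ)` carrying the minimal unitary extension of an isometry `V` on `E`;
`E` is identified with `E ⊕ 0`. -/
abbrev UExtSpace (V : E →L[ℂ] E) : Type _ := WithLp 2 (E × Hardy (V.range)ᗮ)

/-- The inclusion of `E` in the space of the minimal unitary extension. -/
def uextIncl (V : E →L[ℂ] E) : E →ₗᵢ[ℂ] UExtSpace V where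
  toFun e := WithLp.toLp 2 (e, 0)
  map_add' x y := WithLp.ofLp_injective 2 (Prod.ext rfl (add_zero _).symm)
  map_smul' c x := WithLp.ofLp_injective 2 (Prod.ext rfl (smul_zero c).symm)
  norm_map' x := by simp

/-- The inverse of the minimal unitary extension of `V`:
`(e, f) ↦ (V* e, (I - V V*) e + z f)`, where `I - V V*` is the projection onto `(ran V)ᗮ`.
Its adjoint, and inverse, is the minimal unitary extension `(e, f) ↦ (V e + f₀, M_z* f)` of `V`. -/
def uextInv (V : E →L[ℂ] E) : UExtSpace V →L[ℂ] UExtSpace V :=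
  (WithLp.prodContinuousLinearEquiv 2 ℂ E (Hardy (V.range)ᗮ)).symm.toContinuousLinearMap ∘L
    (((V.adjoint ∘L WithLp.fstL 2 ℂ E (Hardy (V.range)ᗮ)).prod
      (lp.singleContinuousLinearMap ℂ (fun _ : ℕ => (V.range)ᗮ) 2 0 ∘L
          (V.range)ᗮ.orthogonalProjectionOnto ∘L WithLp.fstL 2 ℂ E (Hardy (V.range)ᗮ)
        + shift (V.range)ᗮ ∘L WithLp.sndL 2 ℂ E (Hardy (V.range)ᗮ))))

/-- `W*` is a minimal unitary extension of the isometry `V` on `E`, which is embedded by `ι`. -/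
structure IsMinimalUnitaryExtension {Q : Type*} [NormedAddCommGroup Q] [InnerProductSpace ℂ Q]
    [CompleteSpace Q] (V : E →L[ℂ] E) (ι : E →ₗᵢ[ℂ] Q) (W : Q →L[ℂ] Q) : Prop where
  mem_unitary : W ∈ unitary (Q →L[ℂ] Q)
  extends' : ∀ e, W.adjoint (ι e) = ι (V e)
  minimal : (⨆ n : ℕ, ι.toLinearMap.range.map (W ^ n).toLinearMap).topologicalClosure = ⊤

theorem uextInv_fst (V : E →L[ℂ] E) (x : UExtSpace V) : (uextInv V x).fst = V.adjoint x.fst := rfl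

theorem uextInv_snd (V : E →L[ℂ] E) (x : UExtSpace V) :
    (uextInv V x).snd = lp.single 2 0 ((V.range)ᗮ.orthogonalProjectionOnto x.fst)
      + shift (V.range)ᗮ x.snd := rfl

theorem Hardy.norm_sq_cons (x : E) (f : Hardy E) :
    ‖(lp.single 2 0 x : Hardy E) + shift E f‖ ^ 2 = ‖x‖ ^ 2 + ‖f‖ ^ 2 := by
  refine (Hardy.hasSum_sq _).unique ?_
  have h := (hasSum_nat_add_iff
    (f := fun n => ‖((lp.single 2 0 x : Hardy E) + shift E f) n‖ ^ 2) 1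
    (g := ‖f‖ ^ 2)).1 ?_
  · simpa [add_comm] using h
  · simpa using Hardy.hasSum_sq f

theorem Hardy.eq_cons (g : Hardy E) :
    ∃ f : Hardy E, g = (lp.single 2 0 (g 0) : Hardy E) + shift E f := by
  have hm : Memℓp (fun n => g (n + 1)) 2 := by
    have := (lp.memℓp g).summable (by norm_num)
    exact memℓp_gen ((summable_nat_add_iff (f := fun n => ‖g n‖ ^ (2 : ENNReal).toReal) 1).2 this)
  refine ⟨⟨_, hm⟩, ?_⟩
  ext n
  cases n with
  | zero => simp
  | succ n =>
    have : shift E ⟨_, hm⟩ (n + 1) = g (n + 1) := rfl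
    simp [this]

theorem isometry_facts {V : E →L[ℂ] E} (hV : ∀ x, ‖V x‖ = ‖x‖) :
    (∀ x, V.adjoint (V x) = x) ∧ (∀ y : (V.range)ᗮ, V.adjoint y = 0) ∧
    (∀ x, (V.range)ᗮ.orthogonalProjectionOnto (V x) = 0) ∧
    (∀ x, ‖V.adjoint x‖ ^ 2 + ‖(V.range)ᗮ.orthogonalProjectionOnto x‖ ^ 2 = ‖x‖ ^ 2) := by
  have h1 : ∀ x, V.adjoint (V x) = x := fun x => by
    have := (ContinuousLinearMap.norm_map_iff_adjoint_comp_self V).1 hV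
    exact DFunLike.congr_fun this x
  have h2 : ∀ y : (V.range)ᗮ, V.adjoint y = 0 := fun y => by
    refine ext_inner_left ℂ fun v => ?_
    rw [ContinuousLinearMap.adjoint_inner_right, inner_zero_right]
    exact (Submodule.mem_orthogonal _ _).1 y.2 _ ⟨v, rfl⟩
  have h3 : ∀ x, (V.range)ᗮ.orthogonalProjectionOnto (V x) = 0 := fun x => by
    rw [Submodule.orthogonalProjectionOnto_eq_zero_iff]
    exact Submodule.le_orthogonal_orthogonal _ ⟨x, rfl⟩
  refine ⟨h1, h2, h3, fun x => ?_⟩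
  have hx : x = V (V.adjoint x) + ((V.range)ᗮ.orthogonalProjectionOnto x : E) := by
    have hm : x - V (V.adjoint x) ∈ (V.range)ᗮ := by
      rw [Submodule.mem_orthogonal]
      rintro _ ⟨v, rfl⟩
      change inner ℂ (V v) _ = 0
      rw [← ContinuousLinearMap.adjoint_inner_right, map_sub, h1, sub_self, inner_zero_right]
    have := Submodule.orthogonalProjectionOnto_mem_subspace_eq_self (K := (V.range)ᗮ) ⟨_, hm⟩
    have h5 := congrArg (Subtype.val) this
    simp only [map_sub, h3, sub_zero] at h5
    rw [h5]; abel
  have horth : inner ℂ (V (V.adjoint x)) ((V.range)ᗮ.orthogonalProjectionOnto x : E) = 0 :=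
    (Submodule.mem_orthogonal _ _).1 ((V.range)ᗮ.orthogonalProjectionOnto x).2 _ ⟨_, rfl⟩
  have := norm_add_sq_eq_norm_sq_add_norm_sq_of_inner_eq_zero _ _ horth
  rw [← hx, hV] at this
  simp only [sq]
  rw [this]; rfl

theorem uextInv_mem_unitary {V : E →L[ℂ] E} (hV : ∀ x, ‖V x‖ = ‖x‖) :
    uextInv V ∈ unitary (UExtSpace V →L[ℂ] UExtSpace V) := by
  obtain ⟨h1, h2, h3, h4⟩ := isometry_facts hV
  have hiso : ∀ x, ‖uextInv V x‖ = ‖x‖ := fun x => by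
    rw [← sq_eq_sq₀ (norm_nonneg _) (norm_nonneg _), WithLp.prod_norm_sq_eq_of_L2,
      WithLp.prod_norm_sq_eq_of_L2]
    change ‖(uextInv V x).fst‖ ^ 2 + ‖(uextInv V x).snd‖ ^ 2 = ‖x.fst‖ ^ 2 + ‖x.snd‖ ^ 2
    rw [uextInv_fst, uextInv_snd, Hardy.norm_sq_cons, ← add_assoc, h4]
  have hadj := (ContinuousLinearMap.norm_map_iff_adjoint_comp_self (uextInv V)).1 hiso
  have hsurj : ∀ y, ∃ x, uextInv V x = y := fun y => by
    obtain ⟨f, hf⟩ := Hardy.eq_cons y.snd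
    refine ⟨WithLp.toLp 2 (V y.fst + (y.snd 0 : (V.range)ᗮ), f), ?_⟩
    have e1 : (uextInv V (WithLp.toLp 2 (V y.fst + (y.snd 0 : (V.range)ᗮ), f))).fst = y.fst := by
      rw [uextInv_fst]; simp [h1, h2]
    have e2 : (uextInv V (WithLp.toLp 2 (V y.fst + (y.snd 0 : (V.range)ᗮ), f))).snd = y.snd := by
      rw [uextInv_snd, hf]; simp [h3]
    exact WithLp.ofLp_injective 2 (Prod.ext e1 e2)
  rw [Unitary.mem_iff]
  refine ⟨hadj, ?_⟩
  ext1 y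
  obtain ⟨x, rfl⟩ := hsurj y
  have : (uextInv V).adjoint (uextInv V x) = x := DFunLike.congr_fun hadj x
  change uextInv V ((uextInv V).adjoint (uextInv V x)) = _
  rw [this]; rfl

theorem uext_isMinimalUnitaryExtension {V : E →L[ℂ] E} (hV : ∀ x, ‖V x‖ = ‖x‖) :
    IsMinimalUnitaryExtension V (uextIncl V) (uextInv V) := by
  obtain ⟨h1, h2, h3, h4⟩ := isometry_facts hV
  have hu := uextInv_mem_unitary hV
  have hE : ∀ e, uextInv V (uextIncl V (V e)) = uextIncl V e := fun e => by
    refine WithLp.ofLp_injective 2 (Prod.ext ?_ ?_)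
    · change (uextInv V (uextIncl V (V e))).fst = _
      rw [uextInv_fst]; exact h1 e
    · change (uextInv V (uextIncl V (V e))).snd = _
      rw [uextInv_snd]; simp [uextIncl, h3]
  refine ⟨hu, fun e => ?_, ?_⟩
  · rw [← hE e]
    exact DFunLike.congr_fun (Unitary.mem_iff.1 hu).1 _
  · set S := ⨆ n : ℕ, (uextIncl V).toLinearMap.range.map ((uextInv V) ^ n).toLinearMap with hS
    have hmem : ∀ n e, ((uextInv V) ^ n) (uextIncl V e) ∈ S := fun n e =>
      Submodule.mem_iSup_of_mem n ⟨_, ⟨e, rfl⟩, rfl⟩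
    have hsingle : ∀ n (l : (V.range)ᗮ), (WithLp.toLp 2 (0, lp.single 2 n l) : UExtSpace V)
        = ((uextInv V) ^ (n + 1)) (uextIncl V l) := by
      intro n l
      induction n with
      | zero =>
        refine WithLp.ofLp_injective 2 (Prod.ext ?_ ?_)
        · change _ = (uextInv V (uextIncl V l)).fst
          rw [uextInv_fst]; exact (h2 l).symm
        · change _ = (uextInv V (uextIncl V l)).snd
          rw [uextInv_snd]; simp [uextIncl]
      | succ n ih =>
        rw [pow_succ']
        change _ = uextInv V (((uextInv V) ^ (n + 1)) (uextIncl V l))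
        rw [← ih]
        refine WithLp.ofLp_injective 2 (Prod.ext ?_ ?_)
        · change _ = (uextInv V _).fst
          rw [uextInv_fst]; simp
        · change _ = (uextInv V _).snd
          rw [uextInv_snd]
          refine lp.ext (funext fun k => ?_)
          cases k with
          | zero => simp [lp.single_apply]
          | succ k => simp [lp.single_apply, Pi.single_apply]
    rw [eq_top_iff]
    rintro ⟨e, f⟩ -
    have hf : (WithLp.toLp 2 (0, f) : UExtSpace V) ∈ S.topologicalClosure := by
      have h := lp.hasSum_single (by norm_num) f
      have h' := h.mapL ((WithLp.prodContinuousLinearEquiv 2 ℂ E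
        (Hardy (V.range)ᗮ)).symm.toContinuousLinearMap ∘L ContinuousLinearMap.inr ℂ E _)
      refine S.isClosed_topologicalClosure.mem_of_tendsto h' (Filter.Eventually.of_forall fun s => ?_)
      refine Submodule.sum_mem _ fun n _ => S.le_topologicalClosure ?_
      have : ((WithLp.prodContinuousLinearEquiv 2 ℂ E
        (Hardy (V.range)ᗮ)).symm.toContinuousLinearMap ∘L ContinuousLinearMap.inr ℂ E _)
          (lp.single 2 n (f n)) = (WithLp.toLp 2 (0, lp.single 2 n (f n)) : UExtSpace V) := rfl
      rw [this, hsingle]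
      exact hmem _ _
    have he : uextIncl V e ∈ S.topologicalClosure := S.le_topologicalClosure (hmem 0 e)
    have : (WithLp.toLp 2 (e, f) : UExtSpace V) = uextIncl V e + WithLp.toLp 2 (0, f) := by
      refine WithLp.ofLp_injective 2 (Prod.ext ?_ ?_) <;> simp [uextIncl]
    rw [this]
    exact add_mem he hf

end MinimalUnitaryExtension

section Extension

variable {E : Type*} [NormedAddCommGroup E] [InnerProductSpace ℂ E] [CompleteSpace E]
  {Q : Type*} [NormedAddCommGroup Q] [InnerProductSpace ℂ Q] [CompleteSpace Q]
  {V : E →L[ℂ] E} {ι : E →ₗᵢ[ℂ] Q} {W : Q →L[ℂ] Q}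

theorem IsMinimalUnitaryExtension.ext (h : IsMinimalUnitaryExtension V ι W)
    {F : Type*} [NormedAddCommGroup F] [InnerProductSpace ℂ F] {A B : Q →L[ℂ] F}
    (hAB : ∀ n e, A ((W ^ n) (ι e)) = B ((W ^ n) (ι e))) : A = B := by
  have hle : (⨆ n : ℕ, ι.toLinearMap.range.map (W ^ n).toLinearMap)
      ≤ LinearMap.ker (A - B).toLinearMap := by
    refine iSup_le fun n => ?_
    rintro _ ⟨_, ⟨e, rfl⟩, rfl⟩
    change (A - B) ((W ^ n) (ι e)) = 0
    rw [sub_apply, hAB, sub_self]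
  have := Submodule.topologicalClosure_minimal _ hle (A - B).isClosed_ker
  rw [h.minimal, top_le_iff] at this
  ext x
  have hx : x ∈ LinearMap.ker (A - B).toLinearMap := this ▸ Submodule.mem_top
  exact sub_eq_zero.1 hx

theorem IsMinimalUnitaryExtension.exists_lift (h : IsMinimalUnitaryExtension V ι W)
    {A : E →L[ℂ] E} (hA : ∀ x, ‖A x‖ = ‖x‖) {c : ℂ} (hc : ‖c‖ = 1)
    (hAV : ∀ x, A (V x) = c • V (A x)) :
    ∃ B : Q →L[ℂ] Q, (∀ x, ‖B x‖ ≤ ‖x‖) ∧ ∀ n e, B ((W ^ n) (ι e)) = (c⁻¹) ^ n • (W ^ n) (ι (A e)) := by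
  have hc0 : c ≠ 0 := by rintro rfl; simp at hc
  let a : (ℕ →₀ E) →ₗ[ℂ] Q := Finsupp.lsum ℂ fun n => (W ^ n).toLinearMap ∘ₗ ι.toLinearMap
  let b : (ℕ →₀ E) →ₗ[ℂ] Q := Finsupp.lsum ℂ fun n =>
    (c⁻¹) ^ n • (W ^ n).toLinearMap ∘ₗ ι.toLinearMap ∘ₗ A.toLinearMap
  have ha : ∀ n e, a (Finsupp.single n e) = (W ^ n) (ι e) := fun n e => by
    simp only [a, Finsupp.lsum_single]; rfl
  have hb : ∀ n e, b (Finsupp.single n e) = (c⁻¹) ^ n • (W ^ n) (ι (A e)) := fun n e => by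
    simp only [b, Finsupp.lsum_single]; rfl
  have hdense : DenseRange a := by
    have hle : (⨆ n : ℕ, ι.toLinearMap.range.map (W ^ n).toLinearMap) ≤ LinearMap.range a := by
      refine iSup_le fun n => ?_
      rintro _ ⟨_, ⟨e, rfl⟩, rfl⟩
      exact ⟨_, ha n e⟩
    have h2 := Submodule.topologicalClosure_mono hle
    rw [h.minimal, top_le_iff] at h2
    have h3 := congrArg (fun S : Submodule ℂ Q => (S : Set Q)) h2
    rw [DenseRange, dense_iff_closure_eq]
    simpa [Submodule.topologicalClosure_coe, LinearMap.coe_range] using h3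
  have hWn : ∀ N x, ‖(W.adjoint ^ N) x‖ = ‖x‖ := fun N x => by
    induction N with
    | zero => rfl
    | succ N ih =>
      rw [pow_succ', ← ih]
      exact ContinuousLinearMap.norm_map_of_mem_unitary (Unitary.star_mem h.mem_unitary) _
  have hWW : ∀ x, W.adjoint (W x) = x := fun x =>
    DFunLike.congr_fun (Unitary.mem_iff.1 h.mem_unitary).1 x
  have hWWn : ∀ n x, (W.adjoint ^ n) ((W ^ n) x) = x := fun n => by
    induction n with
    | zero => intro x; rfl
    | succ n ih =>
      intro x
      rw [pow_succ, pow_succ']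
      change (W.adjoint ^ n) (W.adjoint (W ((W ^ n) x))) = x
      rw [hWW, ih]
  have hιn : ∀ k e, (W.adjoint ^ k) (ι e) = ι ((V ^ k) e) := fun k e => by
    induction k with
    | zero => rfl
    | succ k ih =>
      rw [pow_succ', pow_succ']
      change W.adjoint ((W.adjoint ^ k) (ι e)) = ι (V ((V ^ k) e))
      rw [ih, h.extends']
  have hAVn : ∀ k e, A ((V ^ k) e) = c ^ k • (V ^ k) (A e) := fun k e => by
    induction k with
    | zero => simp
    | succ k ih =>
      rw [pow_succ', pow_succ']
      change A (V ((V ^ k) e)) = _ • V ((V ^ k) (A e))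
      rw [hAV, ih, map_smul, smul_smul]
  have hnk : ∀ N n e, n ≤ N → (W.adjoint ^ N) ((W ^ n) (ι e)) = ι ((V ^ (N - n)) e) := by
    intro N n e hn
    obtain ⟨k, rfl⟩ := Nat.exists_eq_add_of_le' hn
    rw [pow_add]
    change (W.adjoint ^ k) ((W.adjoint ^ n) ((W ^ n) (ι e))) = _
    rw [hWWn, hιn, Nat.add_sub_cancel]
  have hkey : ∀ (N : ℕ) (f : ℕ →₀ E), (∀ n ∈ f.support, n ≤ N) →
      ∃ x, (W.adjoint ^ N) (a f) = ι x ∧ (W.adjoint ^ N) (b f) = (c⁻¹) ^ N • ι (A x) := by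
    intro N f hf
    refine ⟨∑ n ∈ f.support, (V ^ (N - n)) (f n), ?_, ?_⟩
    · simp only [a, Finsupp.lsum_apply, Finsupp.sum, map_sum]
      exact Finset.sum_congr rfl fun n hn => hnk N n _ (hf n hn)
    · simp only [b, Finsupp.lsum_apply, Finsupp.sum, map_sum, Finset.smul_sum]
      refine Finset.sum_congr rfl fun n hn => ?_
      change (W.adjoint ^ N) ((c⁻¹) ^ n • (W ^ n) (ι (A (f n)))) = _
      rw [map_smul, hnk N n _ (hf n hn), hAVn, map_smul, smul_smul]
      congr 1
      obtain ⟨k, rfl⟩ := Nat.exists_eq_add_of_le (hf n hn)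
      rw [Nat.add_sub_cancel_left, pow_add, mul_assoc, ← mul_pow, inv_mul_cancel₀ hc0]
      simp
  have hnorm : ∀ f, ‖b f‖ ≤ 1 * ‖a f‖ := fun f => by
    obtain ⟨x, h1, h2⟩ := hkey (f.support.sup id) f fun n hn => Finset.le_sup (f := id) hn
    rw [one_mul, ← hWn (f.support.sup id) (b f), ← hWn (f.support.sup id) (a f), h1, h2]
    simp [norm_smul, hc, hA]
  refine ⟨b.extendOfNorm a, fun x => ?_, fun n e => ?_⟩
  · simpa using LinearMap.norm_extendOfNorm_apply_le hdense 1 hnorm x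
  rw [← ha, LinearMap.extendOfNorm_eq hdense ⟨1, hnorm⟩, hb]

theorem IsMinimalUnitaryExtension.unitary_facts (h : IsMinimalUnitaryExtension V ι W) :
    (∀ x, W.adjoint (W x) = x) ∧ (∀ x, W (W.adjoint x) = x) :=
  ⟨fun x => DFunLike.congr_fun (Unitary.mem_iff.1 h.mem_unitary).1 x,
    fun x => DFunLike.congr_fun (Unitary.mem_iff.1 h.mem_unitary).2 x⟩

/-- `U = (U₁, U₂)` is a `q`-commuting pair of unitaries such that `U_j*` extends the operator `V_j` on
the space embedded by `ι`, and such that `U₁* U₂* = q W*`. -/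
def IsCanonicalExtension (q : ℂ) (ι : E →ₗᵢ[ℂ] Q) (V₁ V₂ : E →L[ℂ] E) (W : Q →L[ℂ] Q)
    (U : (Q →L[ℂ] Q) × (Q →L[ℂ] Q)) : Prop :=
  U.1 ∈ unitary (Q →L[ℂ] Q) ∧ U.2 ∈ unitary (Q →L[ℂ] Q) ∧
  U.1 ∘L U.2 = q • (U.2 ∘L U.1) ∧
  (∀ x, U.1.adjoint (ι x) = ι (V₁ x)) ∧ (∀ x, U.2.adjoint (ι x) = ι (V₂ x)) ∧
  U.1.adjoint ∘L U.2.adjoint = q • W.adjoint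

/-- Isometries `V₁, V₂` with `V₂ V₁ = V` and `V₁ V₂ = q V` extend to a unique pair of unitaries with
the analogous property for the minimal unitary extension of `V`. -/
theorem IsMinimalUnitaryExtension.existsUnique_pair (h : IsMinimalUnitaryExtension V ι W)
    {V₁ V₂ : E →L[ℂ] E} (h₁ : ∀ x, ‖V₁ x‖ = ‖x‖) (h₂ : ∀ x, ‖V₂ x‖ = ‖x‖) {q : ℂ} (hq : ‖q‖ = 1)
    (h21 : ∀ x, V₂ (V₁ x) = V x) (h12 : ∀ x, V₁ (V₂ x) = q • V x) :
    ∃! U, IsCanonicalExtension q ι V₁ V₂ W U := by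
  have hq0 : q ≠ 0 := by rintro rfl; simp at hq
  have hqi : q⁻¹ = (starRingEnd ℂ) q := by
    rw [Complex.inv_def, Complex.normSq_eq_norm_sq, hq]; simp
  obtain ⟨hW1, hW2⟩ := h.unitary_facts
  have hWn1 : ∀ n e, W ((W ^ n) e) = (W ^ (n + 1)) e := fun n e => by rw [pow_succ']; rfl
  have hVV : ∀ n e, (W ^ (n + 1)) (ι (V e)) = (W ^ n) (ι e) := fun n e => by
    rw [pow_succ, ← h.extends']
    change (W ^ n) (W (W.adjoint (ι e))) = _
    rw [hW2]
  obtain ⟨B₁, hn₁, hB₁⟩ := h.exists_lift h₁ hq (fun x => by rw [← h21, ← h12])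
  obtain ⟨B₂, hn₂, hB₂⟩ := h.exists_lift h₂ (c := q⁻¹) (by simp [hq]) (fun x => by
    rw [← h21 (V₂ x), h12, map_smul, smul_smul, inv_mul_cancel₀ hq0, one_smul])
  simp only [inv_inv] at hB₂
  have hB12 : ∀ x, W (B₁ (B₂ x)) = q • x := by
    have : W ∘L B₁ ∘L B₂ = q • ContinuousLinearMap.id ℂ Q := h.ext fun n e => by
      change W (B₁ (B₂ ((W ^ n) (ι e)))) = q • (W ^ n) (ι e)
      rw [hB₂, map_smul, hB₁, h12, smul_smul, ← mul_pow, mul_inv_cancel₀ hq0, one_pow, one_smul,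
        map_smul, map_smul, map_smul, hWn1, hVV]
    exact fun x => DFunLike.congr_fun this x
  have hB21 : ∀ x, W (B₂ (B₁ x)) = x := by
    have : W ∘L B₂ ∘L B₁ = ContinuousLinearMap.id ℂ Q := h.ext fun n e => by
      change W (B₂ (B₁ ((W ^ n) (ι e)))) = (W ^ n) (ι e)
      rw [hB₁, map_smul, hB₂, h21, smul_smul, ← mul_pow, inv_mul_cancel₀ hq0, one_pow, one_smul,
        hWn1, hVV]
    exact fun x => DFunLike.congr_fun this x
  have hB12' : ∀ x, B₁ (B₂ x) = q • W.adjoint x := fun x => by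
    rw [← hW1 (B₁ (B₂ x)), hB12, map_smul]
  have hB21' : ∀ x, B₂ (B₁ x) = W.adjoint x := fun x => by
    rw [← hW1 (B₂ (B₁ x)), hB21]
  have hWn : ∀ x, ‖W.adjoint x‖ = ‖x‖ :=
    ContinuousLinearMap.norm_map_of_mem_unitary (Unitary.star_mem h.mem_unitary)
  have hi₁ : ∀ x, ‖B₁ x‖ = ‖x‖ := fun x => le_antisymm (hn₁ x) (by
    rw [← hWn x, ← hB21']; exact hn₂ _)
  have hi₂ : ∀ x, ‖B₂ x‖ = ‖x‖ := fun x => le_antisymm (hn₂ x) (by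
    have := hn₁ (B₂ x)
    rwa [hB12', norm_smul, hq, one_mul, hWn] at this)
  have huni : ∀ B : Q →L[ℂ] Q, (∀ x, ‖B x‖ = ‖x‖) → (∀ y, ∃ x, B x = y) →
      B ∈ unitary (Q →L[ℂ] Q) := fun B hB hs => by
    have hadj := (ContinuousLinearMap.norm_map_iff_adjoint_comp_self B).1 hB
    refine Unitary.mem_iff.2 ⟨hadj, ?_⟩
    ext1 y
    obtain ⟨x, rfl⟩ := hs y
    change B (B.adjoint (B x)) = B x
    congr 1
    exact DFunLike.congr_fun hadj x
  have hu₁ : B₁ ∈ unitary (Q →L[ℂ] Q) := huni B₁ hi₁ fun y =>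
    ⟨q⁻¹ • B₂ (W y), by rw [map_smul, hB12', hW1, smul_smul, inv_mul_cancel₀ hq0, one_smul]⟩
  have hu₂ : B₂ ∈ unitary (Q →L[ℂ] Q) := huni B₂ hi₂ fun y =>
    ⟨B₁ (W y), by rw [hB21', hW1]⟩
  have e12 : B₁ ∘L B₂ = q • W.adjoint := by ext1 x; exact hB12' x
  have e21 : B₂ ∘L B₁ = W.adjoint := by ext1 x; exact hB21' x
  refine ⟨(B₁.adjoint, B₂.adjoint), ⟨Unitary.star_mem hu₁, Unitary.star_mem hu₂, ?_, ?_, ?_, ?_⟩, ?_⟩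
  · rw [← ContinuousLinearMap.adjoint_comp, ← ContinuousLinearMap.adjoint_comp, e12, e21, map_smulₛₗ,
      smul_smul, ← hqi, mul_inv_cancel₀ hq0, one_smul]
  · intro x
    rw [ContinuousLinearMap.adjoint_adjoint]
    simpa using hB₁ 0 x
  · intro x
    rw [ContinuousLinearMap.adjoint_adjoint]
    simpa using hB₂ 0 x
  · rw [ContinuousLinearMap.adjoint_adjoint, ContinuousLinearMap.adjoint_adjoint, e12]
  · rintro ⟨U₁, U₂⟩ ⟨hU₁, hU₂, hcomm, hx₁, hx₂, hprod⟩
    simp only at hU₁ hU₂ hcomm hx₁ hx₂ hprod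
    have p21 : U₂ ∘L U₁ = q⁻¹ • W := by
      have := congrArg ContinuousLinearMap.adjoint hprod
      rwa [ContinuousLinearMap.adjoint_comp, map_smulₛₗ, ContinuousLinearMap.adjoint_adjoint,
        ContinuousLinearMap.adjoint_adjoint, ContinuousLinearMap.adjoint_adjoint, ← hqi] at this
    have p12 : U₁ ∘L U₂ = W := by
      rw [hcomm, p21, smul_smul, mul_inv_cancel₀ hq0, one_smul]
    have p12' : ∀ x, U₁ (U₂ x) = W x := fun x => DFunLike.congr_fun p12 x
    have p21' : ∀ x, U₂ (U₁ x) = q⁻¹ • W x := fun x => DFunLike.congr_fun p21 x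
    have a1 : ∀ x, U₁.adjoint (U₁ x) = x := fun x => DFunLike.congr_fun (Unitary.mem_iff.1 hU₁).1 x
    have a1' : ∀ x, U₁ (U₁.adjoint x) = x := fun x => DFunLike.congr_fun (Unitary.mem_iff.1 hU₁).2 x
    have a2 : ∀ x, U₂.adjoint (U₂ x) = x := fun x => DFunLike.congr_fun (Unitary.mem_iff.1 hU₂).1 x
    have a2' : ∀ x, U₂ (U₂.adjoint x) = x := fun x => DFunLike.congr_fun (Unitary.mem_iff.1 hU₂).2 x
    have c1 : ∀ x, U₁.adjoint (W x) = q⁻¹ • W (U₁.adjoint x) := fun x => by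
      rw [← p21', a1', ← p12', a1]
    have c2 : ∀ x, U₂.adjoint (W x) = q • W (U₂.adjoint x) := fun x => by
      rw [← p12' (U₂.adjoint x), a2']
      have := congrArg (fun y => q • U₂.adjoint y) (p21' x)
      simp only [a2, map_smul, smul_smul, mul_inv_cancel₀ hq0, one_smul] at this
      exact this.symm
    have cn : ∀ (B : Q →L[ℂ] Q) (c : ℂ), (∀ x, B (W x) = c • W (B x)) →
        ∀ n x, B ((W ^ n) x) = c ^ n • (W ^ n) (B x) := fun B c hB n => by
      induction n with
      | zero => intro x; simp
      | succ n ih =>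
        intro x
        rw [← hWn1, hB, ih, map_smul, smul_smul, hWn1, pow_succ' c]
    have r1 : U₁.adjoint = B₁ := h.ext fun n e => by rw [cn _ _ c1, hx₁, hB₁]
    have r2 : U₂.adjoint = B₂ := h.ext fun n e => by rw [cn _ _ c2, hx₂, hB₂]
    rw [← r1, ← r2, ContinuousLinearMap.adjoint_adjoint, ContinuousLinearMap.adjoint_adjoint]

end Extension

/-! ### A single contraction -/

section Contraction

variable {H : Type*} [NormedAddCommGroup H] [InnerProductSpace ℂ H] [CompleteSpace H]

/-- The defect operator `D_T = (I - T* T)^{1/2}`. -/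
def defect (T : H →L[ℂ] H) : H →L[ℂ] H := CFC.sqrt (1 - T.adjoint ∘L T)

/-- The closure of the range of an operator. -/
abbrev RangeClosure (A : H →L[ℂ] H) : Submodule ℂ H := A.range.topologicalClosure

/-- The operator `A`, regarded as an operator into the closure of its range. -/
def toRangeClosure (A : H →L[ℂ] H) : H →L[ℂ] RangeClosure A :=
  A.codRestrict _ fun x => A.range.le_topologicalClosure ⟨x, rfl⟩

@[simp] theorem coe_toRangeClosure (A : H →L[ℂ] H) (h : H) : (toRangeClosure A h : H) = A h := rfl

theorem denseRange_toRangeClosure (A : H →L[ℂ] H) : DenseRange (toRangeClosure A) := by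
  intro x
  have hx : (x : H) ∈ closure (A.range : Set H) := x.2
  rw [closure_subtype]
  convert hx using 2
  ext y
  constructor
  · rintro ⟨_, ⟨h, rfl⟩, rfl⟩
    exact ⟨h, rfl⟩
  · rintro ⟨h, rfl⟩
    exact ⟨_, ⟨h, rfl⟩, rfl⟩

/-- The defect space `𝒟_T`, the closure of the range of `D_T`. -/
abbrev DefectSpace (T : H →L[ℂ] H) : Submodule ℂ H := RangeClosure (defect T)

theorem one_sub_nonneg {T : H →L[ℂ] H} (hT : ‖T‖ ≤ 1) : 0 ≤ 1 - T.adjoint ∘L T := by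
  rw [ContinuousLinearMap.nonneg_iff_isPositive, ContinuousLinearMap.isPositive_iff_complex]
  intro x
  have h1 : inner ℂ ((1 - T.adjoint ∘L T) x) x = (((‖x‖ ^ 2 - ‖T x‖ ^ 2 : ℝ)) : ℂ) := by
    rw [sub_apply, inner_sub_left]
    change inner ℂ x x - inner ℂ (T.adjoint (T x)) x = _
    rw [ContinuousLinearMap.adjoint_inner_left, inner_self_eq_norm_sq_to_K,
      inner_self_eq_norm_sq_to_K]
    push_cast
    rfl
  have h2 : ‖T x‖ ≤ ‖x‖ := by
    simpa using (T.le_opNorm x).trans (mul_le_mul_of_nonneg_right hT (norm_nonneg x))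
  rw [h1]
  refine ⟨rfl, ?_⟩
  simp only [RCLike.re_to_complex, Complex.ofReal_re, sub_nonneg]
  gcongr

theorem sqrt_apply_apply {P : H →L[ℂ] H} (hP : 0 ≤ P) (x : H) :
    CFC.sqrt P (CFC.sqrt P x) = P x :=
  DFunLike.congr_fun (CFC.sqrt_mul_sqrt_self P hP) x

theorem sqrt_inner (P : H →L[ℂ] H) (x y : H) :
    inner ℂ (CFC.sqrt P x) y = inner ℂ x (CFC.sqrt P y) :=
  ((ContinuousLinearMap.nonneg_iff_isPositive _).1 (CFC.sqrt_nonneg P)).isSymmetric x y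

theorem sqrt_norm_sq {P : H →L[ℂ] H} (hP : 0 ≤ P) (x : H) :
    ‖CFC.sqrt P x‖ ^ 2 = (inner ℂ (P x) x : ℂ).re := by
  rw [← sqrt_apply_apply hP, sqrt_inner, ← inner_self_eq_norm_sq (𝕜 := ℂ)]; rfl

theorem defect_apply_apply {T : H →L[ℂ] H} (hT : ‖T‖ ≤ 1) (x : H) :
    defect T (defect T x) = x - T.adjoint (T x) :=
  sqrt_apply_apply (one_sub_nonneg hT) x

theorem defect_norm_sq {T : H →L[ℂ] H} (hT : ‖T‖ ≤ 1) (x : H) :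
    ‖defect T x‖ ^ 2 = ‖x‖ ^ 2 - ‖T x‖ ^ 2 := by
  rw [defect, sqrt_norm_sq (one_sub_nonneg hT), sub_apply, inner_sub_left]
  change (inner ℂ x x - inner ℂ (T.adjoint (T x)) x : ℂ).re = _
  rw [ContinuousLinearMap.adjoint_inner_left, Complex.sub_re]
  congr 1 <;> exact inner_self_eq_norm_sq (𝕜 := ℂ) _

theorem norm_adjoint_le {T : H →L[ℂ] H} (hT : ‖T‖ ≤ 1) : ‖T.adjoint‖ ≤ 1 := by
  rwa [LinearIsometryEquiv.norm_map]

theorem norm_apply_le {T : H →L[ℂ] H} (hT : ‖T‖ ≤ 1) (x : H) : ‖T x‖ ≤ ‖x‖ := by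
  simpa using (T.le_opNorm x).trans (mul_le_mul_of_nonneg_right hT (norm_nonneg x))

theorem norm_pow_apply_le {T : H →L[ℂ] H} (hT : ‖T‖ ≤ 1) (n : ℕ) (x : H) :
    ‖(T ^ n) x‖ ≤ ‖x‖ := by
  induction n with
  | zero => simp
  | succ n ih => rw [pow_succ']; exact (norm_apply_le hT _).trans ih

theorem pow_adjoint (T : H →L[ℂ] H) (n : ℕ) : (T ^ n).adjoint = T.adjoint ^ n := star_pow T n

theorem norm_sq_sub_le {T : H →L[ℂ] H} (hT : ‖T‖ ≤ 1) (m k : ℕ) (h : H) :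
    ‖(T ^ m * T.adjoint ^ m) h - (T ^ (m + k) * T.adjoint ^ (m + k)) h‖ ^ 2
      ≤ ‖(T.adjoint ^ m) h‖ ^ 2 - ‖(T.adjoint ^ (m + k)) h‖ ^ 2 := by
  set y := (T.adjoint ^ m) h with hy
  have e1 : (T.adjoint ^ (m + k)) h = (T.adjoint ^ k) y := by
    rw [add_comm, pow_add]; rfl
  have e2 : (T ^ (m + k) * T.adjoint ^ (m + k)) h = (T ^ m) ((T ^ k) ((T.adjoint ^ k) y)) := by
    change (T ^ (m + k)) ((T.adjoint ^ (m + k)) h) = _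
    rw [e1, pow_add]; rfl
  rw [e1, e2]
  change ‖(T ^ m) y - _‖ ^ 2 ≤ _
  rw [← map_sub]
  have h1 := norm_pow_apply_le hT m (y - (T ^ k) ((T.adjoint ^ k) y))
  have h2 := norm_pow_apply_le hT k ((T.adjoint ^ k) y)
  have h3 : (inner ℂ y ((T ^ k) ((T.adjoint ^ k) y)) : ℂ).re = ‖(T.adjoint ^ k) y‖ ^ 2 := by
    rw [← ContinuousLinearMap.adjoint_inner_left, pow_adjoint]
    exact inner_self_eq_norm_sq (𝕜 := ℂ) _
  have h4 := norm_sub_sq (𝕜 := ℂ) y ((T ^ k) ((T.adjoint ^ k) y))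
  simp only [RCLike.re_to_complex] at h4
  rw [h3] at h4
  have h5 := pow_le_pow_left₀ (norm_nonneg _) h1 2
  have h6 := pow_le_pow_left₀ (norm_nonneg _) h2 2
  linarith

theorem antitone_norm_sq {T : H →L[ℂ] H} (hT : ‖T‖ ≤ 1) (h : H) :
    Antitone fun n => ‖(T.adjoint ^ n) h‖ ^ 2 := by
  refine antitone_nat_of_succ_le fun n => ?_
  gcongr
  rw [pow_succ']
  exact norm_apply_le (norm_adjoint_le hT) _

theorem exists_asymptotic {T : H →L[ℂ] H} (hT : ‖T‖ ≤ 1) :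
    ∃ P : H →L[ℂ] H, ∀ h, Filter.Tendsto (fun n => (T ^ n * T.adjoint ^ n) h) Filter.atTop
      (nhds (P h)) := by
  have hlim : ∀ h, ∃ y, Filter.Tendsto (fun n => (T ^ n * T.adjoint ^ n) h) Filter.atTop
      (nhds y) := fun h => by
    refine cauchySeq_tendsto_of_complete ?_
    have hc : CauchySeq fun n => ‖(T.adjoint ^ n) h‖ ^ 2 :=
      (tendsto_atTop_ciInf (antitone_norm_sq hT h)
        ⟨0, by rintro _ ⟨n, rfl⟩; positivity⟩).cauchySeq
    rw [Metric.cauchySeq_iff'] at hc ⊢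
    intro ε hε
    obtain ⟨N, hN⟩ := hc (ε ^ 2) (by positivity)
    refine ⟨N, fun n hn => ?_⟩
    obtain ⟨k, rfl⟩ := Nat.exists_eq_add_of_le hn
    have h1 := hN _ hn
    rw [dist_comm, Real.dist_eq] at h1
    have h2 := norm_sq_sub_le hT N k h
    rw [dist_comm, dist_eq_norm]
    refine lt_of_pow_lt_pow_left₀ 2 hε.le (lt_of_le_of_lt (h2.trans (le_abs_self _)) h1)
  choose y hy using hlim
  exact ⟨continuousLinearMapOfTendsto (fun n => T ^ n * T.adjoint ^ n) (f := y)
    (tendsto_pi_nhds.2 hy), hy⟩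

/-- The limit of `Tⁿ T*ⁿ` in the strong operator topology. -/
def asymptoticLimit (T : H →L[ℂ] H) (hT : ‖T‖ ≤ 1) : H →L[ℂ] H := (exists_asymptotic hT).choose

theorem tendsto_asymptoticLimit {T : H →L[ℂ] H} (hT : ‖T‖ ≤ 1) (h : H) :
    Filter.Tendsto (fun n => (T ^ n * T.adjoint ^ n) h) Filter.atTop
      (nhds (asymptoticLimit T hT h)) := (exists_asymptotic hT).choose_spec h

/-- The operator `Q_{T*}`: the positive square root of the strong limit of `Tⁿ T*ⁿ`. -/
def asymptoticRoot (T : H →L[ℂ] H) (hT : ‖T‖ ≤ 1) : H →L[ℂ] H := CFC.sqrt (asymptoticLimit T hT)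

theorem tendsto_inner_asymptoticLimit {T : H →L[ℂ] H} (hT : ‖T‖ ≤ 1) (h : H) :
    Filter.Tendsto (fun n => ((‖(T.adjoint ^ n) h‖ ^ 2 : ℝ) : ℂ)) Filter.atTop
      (nhds (inner ℂ (asymptoticLimit T hT h) h)) := by
  have := (tendsto_asymptoticLimit hT h).inner (𝕜 := ℂ) (tendsto_const_nhds (x := h))
  refine this.congr fun n => ?_
  change inner ℂ ((T ^ n) ((T.adjoint ^ n) h)) h = _
  rw [← ContinuousLinearMap.adjoint_inner_right, pow_adjoint, inner_self_eq_norm_sq_to_K]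
  push_cast
  rfl

theorem asymptoticLimit_nonneg {T : H →L[ℂ] H} (hT : ‖T‖ ≤ 1) : 0 ≤ asymptoticLimit T hT := by
  rw [ContinuousLinearMap.nonneg_iff_isPositive, ContinuousLinearMap.isPositive_iff_complex]
  intro x
  have h := tendsto_inner_asymptoticLimit hT x
  have him := (Complex.continuous_im.tendsto _).comp h
  have hre := (Complex.continuous_re.tendsto _).comp h
  have h0 : (inner ℂ (asymptoticLimit T hT x) x : ℂ).im = 0 :=
    tendsto_nhds_unique him (by
      simpa only [Function.comp_def, Complex.ofReal_im] using tendsto_const_nhds)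
  refine ⟨Complex.ext rfl (by simpa using h0.symm), ge_of_tendsto' hre fun n => ?_⟩
  simp only [Function.comp_def, Complex.ofReal_re]
  positivity

theorem tendsto_norm_asymptoticRoot {T : H →L[ℂ] H} (hT : ‖T‖ ≤ 1) (h : H) :
    Filter.Tendsto (fun n => ‖(T.adjoint ^ n) h‖ ^ 2) Filter.atTop
      (nhds (‖asymptoticRoot T hT h‖ ^ 2)) := by
  rw [asymptoticRoot, sqrt_norm_sq (asymptoticLimit_nonneg hT)]
  exact (Complex.continuous_re.tendsto _).comp (tendsto_inner_asymptoticLimit hT h)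

/-- The bounded operator `C` on the closure of the range of `B` with `C (B h) = B (A h)`; it exists
as soon as `‖B (A h)‖ ≤ c ‖B h‖` for some `c` and all `h`. -/
def inducedOp (B A : H →L[ℂ] H) : RangeClosure B →L[ℂ] RangeClosure B :=
  (toRangeClosure B ∘L A).toLinearMap.extendOfNorm (toRangeClosure B).toLinearMap

theorem inducedOp_apply {B A : H →L[ℂ] H} (h : ∀ x, ‖B (A x)‖ ≤ ‖B x‖) (x : H) :
    inducedOp B A (toRangeClosure B x) = toRangeClosure B (A x) :=
  LinearMap.extendOfNorm_eq (f := (toRangeClosure B ∘L A).toLinearMap)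
    (e := (toRangeClosure B).toLinearMap) (denseRange_toRangeClosure B)
    ⟨1, fun x => by simpa using h x⟩ x

theorem norm_inducedOp_le {B A : H →L[ℂ] H} (h : ∀ x, ‖B (A x)‖ ≤ ‖B x‖) (x : RangeClosure B) :
    ‖inducedOp B A x‖ ≤ ‖x‖ :=
  (LinearMap.norm_extendOfNorm_apply_le (f := (toRangeClosure B ∘L A).toLinearMap)
    (e := (toRangeClosure B).toLinearMap) (denseRange_toRangeClosure B) 1
    (fun x => by simpa using h x) x).trans_eq (one_mul _)

/-- The space `closure (ran Q_{T*})`. -/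
abbrev AsymptoticSpace (T : H →L[ℂ] H) (hT : ‖T‖ ≤ 1) : Submodule ℂ H :=
  RangeClosure (asymptoticRoot T hT)

/-- The isometry `X*` on `closure (ran Q_{T*})` with `X* Q_{T*} h = Q_{T*} T* h`. -/
def asymptoticIsometry (T : H →L[ℂ] H) (hT : ‖T‖ ≤ 1) :
    AsymptoticSpace T hT →L[ℂ] AsymptoticSpace T hT :=
  inducedOp (asymptoticRoot T hT) T.adjoint

theorem norm_asymptoticRoot_adjoint {T : H →L[ℂ] H} (hT : ‖T‖ ≤ 1) (h : H) :
    ‖asymptoticRoot T hT (T.adjoint h)‖ = ‖asymptoticRoot T hT h‖ := by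
  rw [← sq_eq_sq₀ (norm_nonneg _) (norm_nonneg _)]
  refine tendsto_nhds_unique (tendsto_norm_asymptoticRoot hT (T.adjoint h)) ?_
  refine ((Filter.tendsto_add_atTop_iff_nat 1).2 (tendsto_norm_asymptoticRoot hT h)).congr fun n => ?_
  rw [pow_succ]; rfl

theorem asymptoticIsometry_apply {T : H →L[ℂ] H} (hT : ‖T‖ ≤ 1) (h : H) :
    asymptoticIsometry T hT (toRangeClosure (asymptoticRoot T hT) h)
      = toRangeClosure (asymptoticRoot T hT) (T.adjoint h) :=
  inducedOp_apply (fun x => (norm_asymptoticRoot_adjoint hT x).le) h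

theorem norm_asymptoticIsometry {T : H →L[ℂ] H} (hT : ‖T‖ ≤ 1) (x : AsymptoticSpace T hT) :
    ‖asymptoticIsometry T hT x‖ = ‖x‖ := by
  refine (denseRange_toRangeClosure (asymptoticRoot T hT)).induction_on
    (p := fun x => ‖asymptoticIsometry T hT x‖ = ‖x‖) x
    (isClosed_eq (by fun_prop) (by fun_prop)) fun h => ?_
  rw [asymptoticIsometry_apply]
  exact norm_asymptoticRoot_adjoint hT h

/-- The space `𝒬_{T*}` of the minimal unitary extension of `X*`. -/
abbrev QSpace (T : H →L[ℂ] H) (hT : ‖T‖ ≤ 1) : Type _ := UExtSpace (asymptoticIsometry T hT)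

/-- The unitary `W_D` on `𝒬_{T*}`, whose adjoint is the minimal unitary extension of `X*`. -/
def douglasUnitary (T : H →L[ℂ] H) (hT : ‖T‖ ≤ 1) : QSpace T hT →L[ℂ] QSpace T hT :=
  uextInv (asymptoticIsometry T hT)

theorem douglasUnitary_isMinimal {T : H →L[ℂ] H} (hT : ‖T‖ ≤ 1) :
    IsMinimalUnitaryExtension (asymptoticIsometry T hT) (uextIncl (asymptoticIsometry T hT))
      (douglasUnitary T hT) :=
  uext_isMinimalUnitaryExtension (norm_asymptoticIsometry hT)

theorem observability_sum_le {T : H →L[ℂ] H} (hT : ‖T‖ ≤ 1) (h : H) (s : Finset ℕ) :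
    ∑ n ∈ s, ‖toRangeClosure (defect T.adjoint) ((T.adjoint ^ n) h)‖ ^ 2 ≤ ‖h‖ ^ 2 := by
  have hN : ∀ N, ∑ n ∈ Finset.range N, ‖toRangeClosure (defect T.adjoint) ((T.adjoint ^ n) h)‖ ^ 2
      = ‖h‖ ^ 2 - ‖(T.adjoint ^ N) h‖ ^ 2 := fun N => by
    induction N with
    | zero => simp
    | succ N ih =>
      rw [Finset.sum_range_succ, ih, Submodule.coe_norm, coe_toRangeClosure,
        defect_norm_sq (norm_adjoint_le hT), pow_succ' T.adjoint]
      change _ + (_ - ‖T.adjoint ((T.adjoint ^ N) h)‖ ^ 2) = _ - ‖T.adjoint ((T.adjoint ^ N) h)‖ ^ 2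
      ring
  refine (Finset.sum_le_sum_of_subset_of_nonneg (t := Finset.range (s.sup id + 1))
    (fun n hn => ?_) fun _ _ _ => by positivity).trans ?_
  · have : n ≤ s.sup id := Finset.le_sup (f := id) hn
    simpa using Nat.lt_succ_of_le this
  · rw [hN]
    have : 0 ≤ ‖(T.adjoint ^ (s.sup id + 1)) h‖ ^ 2 := by positivity
    linarith

/-- The observability operator `𝒪 : H → H²(𝒟_{T*})`, `𝒪 h = ∑ zⁿ D_{T*} T*ⁿ h`. -/
def observability (T : H →L[ℂ] H) (hT : ‖T‖ ≤ 1) : H →L[ℂ] Hardy (DefectSpace T.adjoint) :=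
  LinearMap.mkContinuous
    { toFun := fun h => ⟨fun n => toRangeClosure (defect T.adjoint) ((T.adjoint ^ n) h),
        Hardy.memlp_of_sum_le _ (observability_sum_le hT h)⟩
      map_add' := fun x y => lp.ext (funext fun n =>
        (toRangeClosure (defect T.adjoint) ∘L T.adjoint ^ n).map_add x y)
      map_smul' := fun c x => lp.ext (funext fun n =>
        (toRangeClosure (defect T.adjoint) ∘L T.adjoint ^ n).map_smul c x) }
    1 (fun h => Hardy.norm_le_of_sum_le (by positivity) (by
      rw [one_mul]; exact observability_sum_le hT h))

@[simp] theorem observability_apply {T : H →L[ℂ] H} (hT : ‖T‖ ≤ 1) (h : H) (n : ℕ) :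
    observability T hT h n = toRangeClosure (defect T.adjoint) ((T.adjoint ^ n) h) := rfl

/-- The Douglas model space `𝒦_D = H²(𝒟_{T*}) ⊕ 𝒬_{T*}`. -/
abbrev DouglasSpace (T : H →L[ℂ] H) (hT : ‖T‖ ≤ 1) : Type _ :=
  WithLp 2 (Hardy (DefectSpace T.adjoint) × QSpace T hT)

/-- The Douglas embedding `Π_D h = 𝒪 h ⊕ Q_{T*} h`. -/
def douglasEmbedding (T : H →L[ℂ] H) (hT : ‖T‖ ≤ 1) : H →ₗᵢ[ℂ] DouglasSpace T hT where
  toFun h := WithLp.toLp 2 (observability T hT h,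
    uextIncl (asymptoticIsometry T hT) (toRangeClosure (asymptoticRoot T hT) h))
  map_add' x y := WithLp.ofLp_injective 2 (Prod.ext (map_add _ x y) (by simp))
  map_smul' c x := WithLp.ofLp_injective 2 (Prod.ext (map_smul _ c x) (by simp))
  norm_map' h := by
    rw [← sq_eq_sq₀ (norm_nonneg _) (norm_nonneg _), WithLp.prod_norm_sq_eq_of_L2]
    change ‖observability T hT h‖ ^ 2 + ‖uextIncl (asymptoticIsometry T hT)
      (toRangeClosure (asymptoticRoot T hT) h)‖ ^ 2 = ‖h‖ ^ 2
    rw [LinearIsometry.norm_map, Submodule.coe_norm, coe_toRangeClosure]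
    have h1 := (Hardy.hasSum_sq (observability T hT h)).tendsto_sum_nat
    have h2 := h1.add (tendsto_norm_asymptoticRoot hT h)
    refine tendsto_nhds_unique h2 (tendsto_const_nhds.congr fun N => ?_)
    induction N with
    | zero => simp
    | succ N ih =>
      rw [ih, Finset.sum_range_succ, observability_apply, Submodule.coe_norm, coe_toRangeClosure,
        defect_norm_sq (norm_adjoint_le hT), pow_succ' T.adjoint]
      change _ = _ + (_ - ‖T.adjoint ((T.adjoint ^ N) h)‖ ^ 2) + ‖T.adjoint ((T.adjoint ^ N) h)‖ ^ 2
      ring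

end Contraction

/-! ### `q`-commuting contractive pairs -/

section Pair

variable {H : Type*} [NormedAddCommGroup H] [InnerProductSpace ℂ H] [CompleteSpace H]

/-- `(T₁, T₂)` is a `q`-commuting pair of contractions, for a unimodular number `q`. -/
structure IsQCommutingContractivePair (q : ℂ) (T₁ T₂ : H →L[ℂ] H) : Prop where
  norm_q : ‖q‖ = 1
  contraction₁ : ‖T₁‖ ≤ 1
  contraction₂ : ‖T₂‖ ≤ 1
  qcomm : T₁ ∘L T₂ = q • (T₂ ∘L T₁)

variable {q : ℂ} {T₁ T₂ : H →L[ℂ] H}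

namespace IsQCommutingContractivePair

theorem norm_prod (h : IsQCommutingContractivePair q T₁ T₂) : ‖T₁ ∘L T₂‖ ≤ 1 :=
  (T₁.opNorm_comp_le T₂).trans
    (mul_le_one₀ h.contraction₁ (norm_nonneg _) h.contraction₂)

theorem norm_conj (h : IsQCommutingContractivePair q T₁ T₂) : ‖(starRingEnd ℂ) q‖ = 1 := by
  rw [RCLike.norm_conj, h.norm_q]

theorem q_ne_zero (h : IsQCommutingContractivePair q T₁ T₂) : q ≠ 0 := by
  rintro rfl; simpa using h.norm_q

theorem q_inv (h : IsQCommutingContractivePair q T₁ T₂) : q⁻¹ = (starRingEnd ℂ) q := by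
  rw [Complex.inv_def, Complex.normSq_eq_norm_sq, h.norm_q]; simp

theorem adj_apply (_ : IsQCommutingContractivePair q T₁ T₂) (x : H) :
    (T₁ ∘L T₂).adjoint x = T₂.adjoint (T₁.adjoint x) := by
  rw [ContinuousLinearMap.adjoint_comp]; rfl

theorem adj_qcomm (h : IsQCommutingContractivePair q T₁ T₂) (x : H) :
    T₁.adjoint (T₂.adjoint x) = q • T₂.adjoint (T₁.adjoint x) := by
  have := congrArg ContinuousLinearMap.adjoint h.qcomm
  rw [map_smulₛₗ, ContinuousLinearMap.adjoint_comp, ContinuousLinearMap.adjoint_comp, ← h.q_inv]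
    at this
  have h2 := congrArg (fun A : H →L[ℂ] H => q • A x) this
  simp only [smul_apply, smul_smul, mul_inv_cancel₀ h.q_ne_zero, one_smul,
    ContinuousLinearMap.comp_apply] at h2
  exact h2.symm

end IsQCommutingContractivePair

/-- `G = (G₁, G₂)` solves the fundamental equations
`D_{T*} G₁ D_{T*} = T₁* - T₂ T*` and `D_{T*} G₂ D_{T*} = T₂* - q T₁ T*`, where `T = T₁ T₂`. -/
def IsFundamentalPair (q : ℂ) (T₁ T₂ : H →L[ℂ] H)
    (G : (DefectSpace (T₁ ∘L T₂).adjoint →L[ℂ] DefectSpace (T₁ ∘L T₂).adjoint) ×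
      (DefectSpace (T₁ ∘L T₂).adjoint →L[ℂ] DefectSpace (T₁ ∘L T₂).adjoint)) : Prop :=
  (∀ x, defect (T₁ ∘L T₂).adjoint (G.1 (toRangeClosure (defect (T₁ ∘L T₂).adjoint) x))
      = T₁.adjoint x - T₂ ((T₁ ∘L T₂).adjoint x)) ∧
  (∀ x, defect (T₁ ∘L T₂).adjoint (G.2 (toRangeClosure (defect (T₁ ∘L T₂).adjoint) x))
      = T₂.adjoint x - q • T₁ ((T₁ ∘L T₂).adjoint x))

theorem exists_sandwich (D A B : H →L[ℂ] H) (hD : ∀ x y, inner ℂ (D x) y = inner ℂ x (D y))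
    (hA : ∀ x, ‖A x‖ ≤ ‖D x‖) (hB : ∀ x, ‖B x‖ ≤ ‖D x‖) :
    ∃ G : RangeClosure D →L[ℂ] RangeClosure D, ∀ x, D (G (toRangeClosure D x)) = B.adjoint (A x) := by
  have hext : ∀ C : H →L[ℂ] H, (∀ x, ‖C x‖ ≤ ‖D x‖) →
      ∃ C' : RangeClosure D →L[ℂ] H, ∀ x, C' (toRangeClosure D x) = C x := fun C hC =>
    ⟨C.toLinearMap.extendOfNorm (toRangeClosure D).toLinearMap, fun x =>
      LinearMap.extendOfNorm_eq (f := C.toLinearMap) (e := (toRangeClosure D).toLinearMap)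
        (denseRange_toRangeClosure D) ⟨1, fun x => by simpa using hC x⟩ x⟩
  obtain ⟨A', hA'⟩ := hext A hA
  obtain ⟨B', hB'⟩ := hext B hB
  refine ⟨B'.adjoint ∘L A', fun x => ext_inner_right ℂ fun y => ?_⟩
  rw [hD, ContinuousLinearMap.adjoint_inner_left, ← hB', ← hA']
  change inner ℂ (B'.adjoint (A' (toRangeClosure D x))) (toRangeClosure D y) = _
  rw [ContinuousLinearMap.adjoint_inner_left]

theorem sandwich_unique (D : H →L[ℂ] H) (hD : ∀ x y, inner ℂ (D x) y = inner ℂ x (D y))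
    {G G' : RangeClosure D →L[ℂ] RangeClosure D}
    (h : ∀ x, D (G (toRangeClosure D x)) = D (G' (toRangeClosure D x))) : G = G' := by
  have hker : ∀ u : RangeClosure D, D u = 0 → u = 0 := fun u hu => by
    refine ext_inner_right ℂ fun v => ?_
    rw [inner_zero_left]
    refine (denseRange_toRangeClosure D).induction_on (p := fun v => inner ℂ u v = 0) v
      (isClosed_eq (continuous_const.inner continuous_id) continuous_const) fun y => ?_
    change inner ℂ (u : H) (D y) = 0
    rw [← hD, hu, inner_zero_left]
  refine ContinuousLinearMap.ext fun u => ?_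
  refine (denseRange_toRangeClosure D).induction_on (p := fun u => G u = G' u) u
    (isClosed_eq G.continuous G'.continuous) fun x => ?_
  refine sub_eq_zero.1 (hker _ ?_)
  rw [Submodule.coe_sub, map_sub, h, sub_self]

theorem existsUnique_isFundamentalPair (h : IsQCommutingContractivePair q T₁ T₂) :
    ∃! G, IsFundamentalPair q T₁ T₂ G := by
  have hT := norm_adjoint_le h.norm_prod
  have h1 := norm_adjoint_le h.contraction₁
  have h2 := norm_adjoint_le h.contraction₂
  have hsa : ∀ x y, inner ℂ (defect (T₁ ∘L T₂).adjoint x) y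
      = inner ℂ x (defect (T₁ ∘L T₂).adjoint y) := fun x y => sqrt_inner _ x y
  have hq2 : ∀ x, ‖T₂.adjoint (T₁.adjoint x)‖ = ‖T₁.adjoint (T₂.adjoint x)‖ := fun x => by
    rw [h.adj_qcomm, norm_smul, h.norm_q, one_mul]
  have b1 : ∀ x, ‖defect T₂.adjoint (T₁.adjoint x)‖ ≤ ‖defect (T₁ ∘L T₂).adjoint x‖ := fun x => by
    refine le_of_sq_le_sq ?_ (norm_nonneg _)
    rw [defect_norm_sq h2, defect_norm_sq hT, h.adj_apply]
    have := pow_le_pow_left₀ (norm_nonneg _) (norm_apply_le h1 x) 2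
    linarith
  have b2 : ∀ x, ‖defect T₂.adjoint x‖ ≤ ‖defect (T₁ ∘L T₂).adjoint x‖ := fun x => by
    refine le_of_sq_le_sq ?_ (norm_nonneg _)
    rw [defect_norm_sq h2, defect_norm_sq hT, h.adj_apply, hq2]
    have := pow_le_pow_left₀ (norm_nonneg _) (norm_apply_le h1 (T₂.adjoint x)) 2
    linarith
  have b3 : ∀ x, ‖defect T₁.adjoint (T₂.adjoint x)‖ ≤ ‖defect (T₁ ∘L T₂).adjoint x‖ := fun x => by
    refine le_of_sq_le_sq ?_ (norm_nonneg _)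
    rw [defect_norm_sq h1, defect_norm_sq hT, h.adj_apply, hq2]
    have := pow_le_pow_left₀ (norm_nonneg _) (norm_apply_le h2 x) 2
    linarith
  have b4 : ∀ x, ‖defect T₁.adjoint x‖ ≤ ‖defect (T₁ ∘L T₂).adjoint x‖ := fun x => by
    refine le_of_sq_le_sq ?_ (norm_nonneg _)
    rw [defect_norm_sq h1, defect_norm_sq hT, h.adj_apply]
    have := pow_le_pow_left₀ (norm_nonneg _) (norm_apply_le h2 (T₁.adjoint x)) 2
    linarith
  have hda : ∀ S : H →L[ℂ] H, (defect S).adjoint = defect S := fun S => by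
    symm
    rw [ContinuousLinearMap.eq_adjoint_iff]
    exact fun x y => sqrt_inner _ x y
  obtain ⟨G₁, hG₁⟩ := exists_sandwich (defect (T₁ ∘L T₂).adjoint)
    (defect T₂.adjoint ∘L T₁.adjoint) (defect T₂.adjoint) hsa b1 b2
  obtain ⟨G₂, hG₂⟩ := exists_sandwich (defect (T₁ ∘L T₂).adjoint)
    (defect T₁.adjoint ∘L T₂.adjoint) (defect T₁.adjoint) hsa b3 b4
  refine ⟨(G₁, G₂), ⟨fun x => ?_, fun x => ?_⟩, ?_⟩
  · rw [hG₁, hda, ContinuousLinearMap.comp_apply, defect_apply_apply h2,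
      ContinuousLinearMap.adjoint_adjoint, h.adj_apply]
  · rw [hG₂, hda, ContinuousLinearMap.comp_apply, defect_apply_apply h1,
      ContinuousLinearMap.adjoint_adjoint, h.adj_apply, ← map_smul, h.adj_qcomm]
  · rintro ⟨G₁', G₂'⟩ ⟨h1', h2'⟩
    refine Prod.ext (sandwich_unique _ hsa fun x => ?_) (sandwich_unique _ hsa fun x => ?_)
    · refine (h1' x).trans ?_
      rw [hG₁, hda, ContinuousLinearMap.comp_apply, defect_apply_apply h2,
        ContinuousLinearMap.adjoint_adjoint, h.adj_apply]
    · refine (h2' x).trans ?_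
      rw [hG₂, hda, ContinuousLinearMap.comp_apply, defect_apply_apply h1,
        ContinuousLinearMap.adjoint_adjoint, h.adj_apply, ← map_smul, h.adj_qcomm]

/-- The fundamental operators `(G₁, G₂)` of `(T₁*, T₂*)`: the unique solution of the fundamental
equations. -/
def fundamentalPair (h : IsQCommutingContractivePair q T₁ T₂) :
    (DefectSpace (T₁ ∘L T₂).adjoint →L[ℂ] DefectSpace (T₁ ∘L T₂).adjoint) ×
      (DefectSpace (T₁ ∘L T₂).adjoint →L[ℂ] DefectSpace (T₁ ∘L T₂).adjoint) :=
  (existsUnique_isFundamentalPair h).choose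

theorem fundamentalPair_spec (h : IsQCommutingContractivePair q T₁ T₂) :
    IsFundamentalPair q T₁ T₂ (fundamentalPair h) :=
  (existsUnique_isFundamentalPair h).choose_spec.1

/-- `W = (W₁, W₂)` is a canonical `q`-commuting pair of unitaries of `(T₁, T₂)`: a `q`-commuting pair
of unitaries on `𝒬_{T*}` such that `W_j*` extends the operator `X_j*` on `closure (ran Q_{T*})` with
`X_j* Q_{T*} h = Q_{T*} T_j* h`, and such that `W₁* W₂* = q W_D*`. -/
def IsCanonicalPair (h : IsQCommutingContractivePair q T₁ T₂)
    (W : (QSpace (T₁ ∘L T₂) h.norm_prod →L[ℂ] QSpace (T₁ ∘L T₂) h.norm_prod) ×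
      (QSpace (T₁ ∘L T₂) h.norm_prod →L[ℂ] QSpace (T₁ ∘L T₂) h.norm_prod)) : Prop :=
  IsCanonicalExtension q (uextIncl (asymptoticIsometry (T₁ ∘L T₂) h.norm_prod))
    (inducedOp (asymptoticRoot (T₁ ∘L T₂) h.norm_prod) T₁.adjoint)
    (inducedOp (asymptoticRoot (T₁ ∘L T₂) h.norm_prod) T₂.adjoint)
    (douglasUnitary (T₁ ∘L T₂) h.norm_prod) W

theorem asymptoticRoot_le (h : IsQCommutingContractivePair q T₁ T₂) {S : H →L[ℂ] H} {c : ℂ}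
    (hc : ‖c‖ = 1) (hS : ‖S‖ ≤ 1)
    (hcomm : ∀ x, (T₁ ∘L T₂).adjoint (S x) = c • S ((T₁ ∘L T₂).adjoint x)) (x : H) :
    ‖asymptoticRoot (T₁ ∘L T₂) h.norm_prod (S x)‖ ≤ ‖asymptoticRoot (T₁ ∘L T₂) h.norm_prod x‖ := by
  have hn : ∀ n, ((T₁ ∘L T₂).adjoint ^ n) (S x) = c ^ n • S (((T₁ ∘L T₂).adjoint ^ n) x) := fun n => by
    induction n with
    | zero => simp
    | succ n ih =>
      rw [pow_succ', pow_succ']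
      change (T₁ ∘L T₂).adjoint (((T₁ ∘L T₂).adjoint ^ n) (S x))
        = _ • S ((T₁ ∘L T₂).adjoint (((T₁ ∘L T₂).adjoint ^ n) x))
      rw [ih, map_smul, hcomm, smul_smul, mul_comm]
  refine le_of_sq_le_sq ?_ (norm_nonneg _)
  refine le_of_tendsto_of_tendsto' (tendsto_norm_asymptoticRoot h.norm_prod (S x))
    (tendsto_norm_asymptoticRoot h.norm_prod x) fun n => ?_
  rw [hn, norm_smul, norm_pow, hc, one_pow, one_mul]
  gcongr
  exact norm_apply_le hS _

theorem asymptoticRoot_adjoint_le (h : IsQCommutingContractivePair q T₁ T₂) :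
    (∀ x, ‖asymptoticRoot (T₁ ∘L T₂) h.norm_prod (T₁.adjoint x)‖
      ≤ ‖asymptoticRoot (T₁ ∘L T₂) h.norm_prod x‖) ∧
    (∀ x, ‖asymptoticRoot (T₁ ∘L T₂) h.norm_prod (T₂.adjoint x)‖
      ≤ ‖asymptoticRoot (T₁ ∘L T₂) h.norm_prod x‖) := by
  constructor
  · refine asymptoticRoot_le h (c := q⁻¹) (by simp [h.norm_q]) (norm_adjoint_le h.contraction₁)
      fun x => ?_
    rw [h.adj_apply, h.adj_apply, h.adj_qcomm, smul_smul, inv_mul_cancel₀ h.q_ne_zero, one_smul]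
  · refine asymptoticRoot_le h h.norm_q (norm_adjoint_le h.contraction₂) fun x => ?_
    rw [h.adj_apply, h.adj_apply, h.adj_qcomm, map_smul]

theorem inducedOp_comp₂₁ (h : IsQCommutingContractivePair q T₁ T₂)
    (x : AsymptoticSpace (T₁ ∘L T₂) h.norm_prod) :
    inducedOp (asymptoticRoot (T₁ ∘L T₂) h.norm_prod) T₂.adjoint
        (inducedOp (asymptoticRoot (T₁ ∘L T₂) h.norm_prod) T₁.adjoint x)
      = asymptoticIsometry (T₁ ∘L T₂) h.norm_prod x := by
  obtain ⟨h1, h2⟩ := asymptoticRoot_adjoint_le h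
  suffices hs : inducedOp (asymptoticRoot (T₁ ∘L T₂) h.norm_prod) T₂.adjoint ∘L
      inducedOp (asymptoticRoot (T₁ ∘L T₂) h.norm_prod) T₁.adjoint
      = asymptoticIsometry (T₁ ∘L T₂) h.norm_prod from DFunLike.congr_fun hs x
  refine DFunLike.coe_injective (DenseRange.equalizer (denseRange_toRangeClosure _)
    (ContinuousLinearMap.continuous _) (ContinuousLinearMap.continuous _) (funext fun y => ?_))
  simp only [Function.comp_apply, ContinuousLinearMap.comp_apply]
  rw [inducedOp_apply h1, inducedOp_apply h2, asymptoticIsometry_apply, h.adj_apply]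

theorem inducedOp_comp₁₂ (h : IsQCommutingContractivePair q T₁ T₂)
    (x : AsymptoticSpace (T₁ ∘L T₂) h.norm_prod) :
    inducedOp (asymptoticRoot (T₁ ∘L T₂) h.norm_prod) T₁.adjoint
        (inducedOp (asymptoticRoot (T₁ ∘L T₂) h.norm_prod) T₂.adjoint x)
      = q • asymptoticIsometry (T₁ ∘L T₂) h.norm_prod x := by
  obtain ⟨h1, h2⟩ := asymptoticRoot_adjoint_le h
  suffices hs : inducedOp (asymptoticRoot (T₁ ∘L T₂) h.norm_prod) T₁.adjoint ∘L
      inducedOp (asymptoticRoot (T₁ ∘L T₂) h.norm_prod) T₂.adjoint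
      = q • asymptoticIsometry (T₁ ∘L T₂) h.norm_prod from DFunLike.congr_fun hs x
  refine DFunLike.coe_injective (DenseRange.equalizer (denseRange_toRangeClosure _)
    (ContinuousLinearMap.continuous _) (ContinuousLinearMap.continuous _) (funext fun y => ?_))
  simp only [Function.comp_apply, ContinuousLinearMap.comp_apply, smul_apply]
  rw [inducedOp_apply h2, inducedOp_apply h1, asymptoticIsometry_apply, h.adj_apply,
    h.adj_qcomm, map_smul]

theorem existsUnique_isCanonicalPair (h : IsQCommutingContractivePair q T₁ T₂) :
    ∃! W, IsCanonicalPair h W := by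
  obtain ⟨h1, h2⟩ := asymptoticRoot_adjoint_le h
  have n1 : ∀ x, ‖inducedOp (asymptoticRoot (T₁ ∘L T₂) h.norm_prod) T₁.adjoint x‖ = ‖x‖ := by
    intro x
    refine le_antisymm (norm_inducedOp_le h1 x) ?_
    rw [← norm_asymptoticIsometry h.norm_prod, ← inducedOp_comp₂₁ h]
    exact norm_inducedOp_le h2 _
  have n2 : ∀ x, ‖inducedOp (asymptoticRoot (T₁ ∘L T₂) h.norm_prod) T₂.adjoint x‖ = ‖x‖ := by
    intro x
    refine le_antisymm (norm_inducedOp_le h2 x) ?_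
    have := norm_inducedOp_le h1
      (inducedOp (asymptoticRoot (T₁ ∘L T₂) h.norm_prod) T₂.adjoint x)
    rwa [inducedOp_comp₁₂ h, norm_smul, h.norm_q, one_mul, norm_asymptoticIsometry] at this
  exact (douglasUnitary_isMinimal h.norm_prod).existsUnique_pair n1 n2 h.norm_q
    (inducedOp_comp₂₁ h) (inducedOp_comp₁₂ h)

/-- The canonical `q`-commuting pair of unitaries `(W₁, W₂)` on `𝒬_{T*}` of `(T₁, T₂)`. -/
def canonicalPair (h : IsQCommutingContractivePair q T₁ T₂) :
    (QSpace (T₁ ∘L T₂) h.norm_prod →L[ℂ] QSpace (T₁ ∘L T₂) h.norm_prod) ×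
      (QSpace (T₁ ∘L T₂) h.norm_prod →L[ℂ] QSpace (T₁ ∘L T₂) h.norm_prod) :=
  (existsUnique_isCanonicalPair h).choose

theorem canonicalPair_spec (h : IsQCommutingContractivePair q T₁ T₂) :
    IsCanonicalPair h (canonicalPair h) :=
  (existsUnique_isCanonicalPair h).choose_spec.1

/-! ### The Douglas model -/

/-- The operator `M_{G₁* + z G₂} R_q ⊕ W₁` on `𝒦_D`. -/
def douglasModel₁ (h : IsQCommutingContractivePair q T₁ T₂) :
    DouglasSpace (T₁ ∘L T₂) h.norm_prod →L[ℂ] DouglasSpace (T₁ ∘L T₂) h.norm_prod :=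
  blockDiag (mulPencil (fundamentalPair h).1.adjoint (fundamentalPair h).2 ∘L rotation _ h.norm_q)
    (canonicalPair h).1

/-- The operator `R_{conj q} M_{G₂* + z G₁} ⊕ W₂` on `𝒦_D`. -/
def douglasModel₂ (h : IsQCommutingContractivePair q T₁ T₂) :
    DouglasSpace (T₁ ∘L T₂) h.norm_prod →L[ℂ] DouglasSpace (T₁ ∘L T₂) h.norm_prod :=
  blockDiag (rotation _ h.norm_conj ∘L mulPencil (fundamentalPair h).2.adjoint (fundamentalPair h).1)
    (canonicalPair h).2

/-- The Douglas isometric lift `V_D = M_z ⊕ W_D` of a contraction `T`, on `𝒦_D`. -/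
def douglasLift (T : H →L[ℂ] H) (hT : ‖T‖ ≤ 1) : DouglasSpace T hT →L[ℂ] DouglasSpace T hT :=
  blockDiag (shift _) (douglasUnitary T hT)

end Pair

/-! ### Pseudo `q`-commuting contractive lifts -/

section Pseudo

variable {H K K' : Type*} [NormedAddCommGroup H] [InnerProductSpace ℂ H] [CompleteSpace H]
  [NormedAddCommGroup K] [InnerProductSpace ℂ K] [CompleteSpace K]
  [NormedAddCommGroup K'] [InnerProductSpace ℂ K'] [CompleteSpace K']

/-- `(W₁, W₂, W)` is a pseudo `q`-commuting contractive operator triple. -/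
structure IsPseudoQTriple (q : ℂ) (W₁ W₂ W : K →L[ℂ] K) : Prop where
  contraction₁ : ‖W₁‖ ≤ 1
  contraction₂ : ‖W₂‖ ≤ 1
  isometry : ∀ x, ‖W x‖ = ‖x‖
  qcomm₁ : W₁ ∘L W = q • (W ∘L W₁)
  qcomm₂ : W₂ ∘L W = (starRingEnd ℂ) q • (W ∘L W₂)
  relation : W₁ = (starRingEnd ℂ) q • (W₂.adjoint ∘L W)

/-- `(Π, W₁, W₂, W)` is a pseudo `q`-commuting contractive lift of `(T₁, T₂, T₁ T₂)`. -/
structure IsPseudoQLift (q : ℂ) (T₁ T₂ : H →L[ℂ] H) (P : H →ₗᵢ[ℂ] K) (W₁ W₂ W : K →L[ℂ] K) : Prop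
    extends IsPseudoQTriple q W₁ W₂ W where
  lift₁ : ∀ x, P (T₁.adjoint x) = W₁.adjoint (P x)
  lift₂ : ∀ x, P (T₂.adjoint x) = W₂.adjoint (P x)
  lift : ∀ x, P (T₂.adjoint (T₁.adjoint x)) = W.adjoint (P x)
  minimal : (⨆ n : ℕ, P.toLinearMap.range.map (W ^ n).toLinearMap).topologicalClosure = ⊤

/-- The lifts `(Π, W₁, W₂, W)` on `K` and `(Π', W₁', W₂', W')` on `K'` are unitarily equivalent: a
unitary `τ : K → K'` satisfies `τ Π = Π'`, `τ W_j = W_j' τ` and `τ W = W' τ`. -/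
def LiftsUnitarilyEquivalent (P : H →ₗᵢ[ℂ] K) (W₁ W₂ W : K →L[ℂ] K)
    (P' : H →ₗᵢ[ℂ] K') (W₁' W₂' W' : K' →L[ℂ] K') : Prop :=
  ∃ τ : K ≃ₗᵢ[ℂ] K', (∀ x, τ (P x) = P' x) ∧ (∀ x, τ (W₁ x) = W₁' (τ x)) ∧
    (∀ x, τ (W₂ x) = W₂' (τ x)) ∧ ∀ x, τ (W x) = W' (τ x)

end Pseudo

end QComm

end

open scoped ComplexConjugate ComplexInnerProductSpace

noncomputable section

set_option linter.unusedSectionVars false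

namespace QComm

/-! ### Minimal isometric lifts, and uniqueness of a pseudo `q`-commuting pair over a fixed one. -/

section MinimalLift

variable {H K K' : Type*} [NormedAddCommGroup H] [InnerProductSpace ℂ H] [CompleteSpace H]
  [NormedAddCommGroup K] [InnerProductSpace ℂ K] [CompleteSpace K]
  [NormedAddCommGroup K'] [InnerProductSpace ℂ K'] [CompleteSpace K']

/-! The argument separates the isometry `W` from the pair `(W₁, W₂)`, since each is rigid for its
own reason.

Forgetting the pair, a pseudo lift is a minimal isometric lift of `T = T₁ T₂`. Such a lift is unique
up to unitary equivalence: the inner products of the vectors `Vⁿ P x`, which span a dense subspace,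
are expressed through powers of `T*` alone (`inner_pow`, `exists_equiv`). The Douglas lift is also
minimal: `P x - V P T* x` is the constant function `D_{T*} x`, and such constants generate the Hardy
summand, after which the vectors `Q_{T*} x` generate the other summand
(`IsModelEmbedding.isMinimalIsometricLift`). This produces `τ`, and the given pair can be conjugated
by it onto `𝒦_D`.

Over a fixed minimal isometric lift there is room for only one pair. The difference `(X₁, X₂)` of
two candidates satisfies the same homogeneous relations and `X_j* P = 0`. The relation `X₁ = q̄ X₂*
V` turns the pairing of `X₂ P x` with `Vⁿ⁺¹ P y` into one with `X₁ Vⁿ P y`; `q`-commutation then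
moves the powers of `V` onto `P H`, where `X₁*` vanishes. Thus `X₂ P = 0`, and minimality gives `X₂
= 0` and `X₁ = 0` (`pair_eq_zero`, `eq_of_relations`).

It remains to see that the model operators satisfy the algebraic relations. On the Hardy summand
these are coefficient computations, and the intertwining with the embedding rests on `D T₁* = G₁ D +
G₂* D T*` and `D T₂* = G₂ D + q G₁* D T*`, with `D = D_{T*}`. On the other summand they follow from
`U₂ U₁ = q̄ W`. Contractivity of the model operators is never estimated: they equal conjugates of
the given contractions. -/

/-- `(P, V)` is a minimal isometric lift of `T`. -/
structure IsMinimalIsometricLift (T : H →L[ℂ] H) (P : H →ₗᵢ[ℂ] K) (V : K →L[ℂ] K) : Prop where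
  isometry : ∀ x, ‖V x‖ = ‖x‖
  lift : ∀ x, P (T.adjoint x) = V.adjoint (P x)
  minimal : (⨆ n : ℕ, P.toLinearMap.range.map (V ^ n).toLinearMap).topologicalClosure = ⊤

/-- The map `(hₙ) ↦ ∑ Vⁿ P hₙ` on finitely supported sequences. -/
def orbitMap (P : H →ₗᵢ[ℂ] K) (V : K →L[ℂ] K) : (ℕ →₀ H) →ₗ[ℂ] K :=
  Finsupp.lsum ℂ fun n => (V ^ n).toLinearMap ∘ₗ P.toLinearMap

theorem orbitMap_single (P : H →ₗᵢ[ℂ] K) (V : K →L[ℂ] K) (n : ℕ) (x : H) :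
    orbitMap P V (Finsupp.single n x) = (V ^ n) (P x) := by
  simp only [orbitMap, Finsupp.lsum_single]; rfl

theorem pow_succ_apply (V : K →L[ℂ] K) (n : ℕ) (x : K) : (V ^ (n + 1)) x = V ((V ^ n) x) := by
  rw [pow_succ']; rfl

theorem mul_conj_eq_one {q : ℂ} (hq : ‖q‖ = 1) : q * (starRingEnd ℂ) q = 1 := by
  rw [Complex.mul_conj, Complex.normSq_eq_norm_sq, hq]; simp

theorem scaled_comm_pow {X V : K →L[ℂ] K} {c : ℂ} (hX : ∀ x, X (V x) = c • V (X x)) (n : ℕ) (x : K) :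
    X ((V ^ n) x) = c ^ n • (V ^ n) (X x) := by
  induction n with
  | zero => simp
  | succ n ih => rw [pow_succ_apply, hX, ih, map_smul, smul_smul, pow_succ_apply, pow_succ']

namespace IsMinimalIsometricLift

variable {T : H →L[ℂ] H} {P : H →ₗᵢ[ℂ] K} {V : K →L[ℂ] K} {P' : H →ₗᵢ[ℂ] K'} {V' : K' →L[ℂ] K'}

theorem adjoint_pow_apply (h : IsMinimalIsometricLift T P V) (n : ℕ) (x : H) :
    (V.adjoint ^ n) (P x) = P ((T.adjoint ^ n) x) := by
  induction n with
  | zero => rfl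
  | succ n ih => rw [pow_succ_apply, pow_succ_apply, ih, h.lift]

theorem inner_map (h : IsMinimalIsometricLift T P V) (x y : K) :
    inner ℂ (V x) (V y) = inner ℂ x y :=
  (LinearMap.norm_map_iff_inner_map_map V).1 h.isometry x y

/-- The Gram matrix of the orbit depends on `T` only. Common powers of `V` cancel because `V` is
isometric, and the surplus power passes to the other side as `V*`, which acts on `P H` as `T*`. With
truncated subtraction at least one of the two exponents is zero, so one formula serves both cases.
-/
theorem inner_pow (h : IsMinimalIsometricLift T P V) (m n : ℕ) (x y : H) :
    inner ℂ ((V ^ m) (P x)) ((V ^ n) (P y))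
      = inner ℂ ((T.adjoint ^ (n - m)) x) ((T.adjoint ^ (m - n)) y) := by
  induction m generalizing n with
  | zero =>
    rw [← ContinuousLinearMap.adjoint_inner_left, pow_adjoint]
    simp only [pow_zero, one_apply_eq_self, Nat.sub_zero, Nat.zero_sub]
    rw [h.adjoint_pow_apply, P.inner_map_map]
  | succ m ih =>
    cases n with
    | zero =>
      rw [← ContinuousLinearMap.adjoint_inner_right, pow_adjoint]
      simp only [pow_zero, one_apply_eq_self, Nat.sub_zero, Nat.zero_sub]
      rw [h.adjoint_pow_apply, P.inner_map_map]
    | succ n => rw [pow_succ_apply, pow_succ_apply, h.inner_map, ih, Nat.add_sub_add_right,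
        Nat.add_sub_add_right]

theorem denseRange_orbitMap (h : IsMinimalIsometricLift T P V) : DenseRange (orbitMap P V) := by
  have hle : (⨆ n : ℕ, P.toLinearMap.range.map (V ^ n).toLinearMap)
      ≤ LinearMap.range (orbitMap P V) := by
    refine iSup_le fun n => ?_
    rintro _ ⟨_, ⟨x, rfl⟩, rfl⟩
    exact ⟨_, orbitMap_single P V n x⟩
  have h2 := Submodule.topologicalClosure_mono hle
  rw [h.minimal, top_le_iff] at h2
  have h3 := congrArg (fun S : Submodule ℂ K => (S : Set K)) h2
  rw [DenseRange, dense_iff_closure_eq]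
  simpa [Submodule.topologicalClosure_coe, LinearMap.coe_range] using h3

theorem ext (h : IsMinimalIsometricLift T P V) {F : Type*} [NormedAddCommGroup F]
    [InnerProductSpace ℂ F] {A B : K →L[ℂ] F}
    (hAB : ∀ n x, A ((V ^ n) (P x)) = B ((V ^ n) (P x))) : A = B := by
  have : A.toLinearMap ∘ₗ orbitMap P V = B.toLinearMap ∘ₗ orbitMap P V :=
    Finsupp.lhom_ext fun n x => by
      rw [LinearMap.comp_apply, LinearMap.comp_apply, orbitMap_single]
      exact hAB n x
  exact DFunLike.coe_injective (h.denseRange_orbitMap.equalizer A.continuous B.continuous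
    (funext fun f => DFunLike.congr_fun this f))

theorem inner_orbitMap (h : IsMinimalIsometricLift T P V) (h' : IsMinimalIsometricLift T P' V')
    (f g : ℕ →₀ H) : inner ℂ (orbitMap P' V' f) (orbitMap P' V' g)
      = inner ℂ (orbitMap P V f) (orbitMap P V g) := by
  simp only [orbitMap, Finsupp.lsum_apply, Finsupp.sum_inner, Finsupp.inner_sum]
  refine Finset.sum_congr rfl fun m _ => Finset.sum_congr rfl fun n _ => ?_
  exact (h'.inner_pow n m _ _).trans (h.inner_pow n m _ _).symm

/-- Minimal isometric lifts of the same operator are unitarily equivalent. -/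
theorem exists_equiv (h : IsMinimalIsometricLift T P V) (h' : IsMinimalIsometricLift T P' V') :
    ∃ τ : K ≃ₗᵢ[ℂ] K', (∀ x, τ (P x) = P' x) ∧ ∀ x, τ (V x) = V' (τ x) := by
  -- Both orbit maps have the same domain of finitely supported sequences, so `τ` is the extension
  -- of the identity there once the two seminorms agree.
  have hn : ∀ f, ‖orbitMap P' V' (LinearEquiv.refl ℂ _ f)‖ = ‖orbitMap P V f‖ := fun f => by
    rw [LinearEquiv.refl_apply, norm_eq_sqrt_re_inner (𝕜 := ℂ), inner_orbitMap h h',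
      ← norm_eq_sqrt_re_inner]
  let τ := (LinearEquiv.refl ℂ (ℕ →₀ H)).extendOfIsometry (orbitMap P V) (orbitMap P' V')
    h.denseRange_orbitMap h'.denseRange_orbitMap hn
  have hτ : ∀ n x, τ ((V ^ n) (P x)) = (V' ^ n) (P' x) := fun n x => by
    rw [← orbitMap_single, ← orbitMap_single]
    exact LinearEquiv.extendOfIsometry_eq _ _ _ h.denseRange_orbitMap h'.denseRange_orbitMap hn _
  refine ⟨τ, hτ 0, fun x => ?_⟩
  refine DFunLike.congr_fun (f := τ.toContinuousLinearEquiv.toContinuousLinearMap ∘L V)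
    (g := V' ∘L τ.toContinuousLinearEquiv.toContinuousLinearMap) (h.ext fun n x => ?_) x
  change τ (V ((V ^ n) (P x))) = V' (τ ((V ^ n) (P x)))
  rw [← pow_succ_apply, hτ, hτ, pow_succ_apply]

/-- A pair with the commutation relations of a pseudo `q`-commuting triple and whose adjoints vanish on
`P H` is zero. -/
theorem pair_eq_zero (h : IsMinimalIsometricLift T P V) {q : ℂ} (hq : ‖q‖ = 1)
    {X₁ X₂ : K →L[ℂ] K} (h₁ : ∀ x, X₁ (V x) = q • V (X₁ x))
    (h₂ : ∀ x, X₂ (V x) = (starRingEnd ℂ) q • V (X₂ x))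
    (hr : X₁ = (starRingEnd ℂ) q • (X₂.adjoint ∘L V))
    (hP₁ : ∀ x, X₁.adjoint (P x) = 0) (hP₂ : ∀ x, X₂.adjoint (P x) = 0) : X₁ = 0 ∧ X₂ = 0 := by
  have hq1 := mul_conj_eq_one hq
  have hr' : ∀ x, X₂.adjoint (V x) = q • X₁ x := fun x => by
    rw [hr, smul_apply, smul_smul, hq1, one_smul]; rfl
  have h0 : ∀ x, X₂ (P x) = 0 := fun x => by
    -- The functional `⟨X₂ P x, ·⟩` is tested on the dense orbit. For `n = 0` it vanishes by `hP₂`;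
    -- for positive powers `X₂* V = q X₁` trades `X₂` for `X₁`.
    have : innerSL ℂ (X₂ (P x)) = 0 := h.ext fun n y => by
      change inner ℂ (X₂ (P x)) ((V ^ n) (P y)) = 0
      rw [← ContinuousLinearMap.adjoint_inner_right]
      cases n with
      | zero =>
        change inner ℂ _ (X₂.adjoint (P y)) = 0
        rw [hP₂, inner_zero_right]
      | succ n =>
        rw [pow_succ_apply, hr', scaled_comm_pow h₁, inner_smul_right, inner_smul_right,
          ← ContinuousLinearMap.adjoint_inner_left, pow_adjoint, h.adjoint_pow_apply,
          ← ContinuousLinearMap.adjoint_inner_left, hP₁, inner_zero_left, mul_zero, mul_zero]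
    exact inner_self_eq_zero.1 (DFunLike.congr_fun this (X₂ (P x)))
  -- Commutation with `V`, up to scalars, spreads the vanishing from `P H` to the whole orbit.
  have hX₂ : X₂ = 0 := h.ext fun n x => by
    rw [scaled_comm_pow h₂, h0, map_zero, smul_zero]; rfl
  refine ⟨?_, hX₂⟩
  rw [hr, hX₂, map_zero, ContinuousLinearMap.zero_comp, smul_zero]

end IsMinimalIsometricLift

theorem IsPseudoQLift.isMinimalIsometricLift {q : ℂ} {T₁ T₂ : H →L[ℂ] H} {P : H →ₗᵢ[ℂ] K}
    {W₁ W₂ W : K →L[ℂ] K} (h : IsPseudoQLift q T₁ T₂ P W₁ W₂ W) :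
    IsMinimalIsometricLift (T₁ ∘L T₂) P W where
  isometry := h.isometry
  lift x := by rw [ContinuousLinearMap.adjoint_comp]; exact h.lift x
  minimal := h.minimal

/-- A triple on a minimal isometric lift that satisfies the algebraic relations of a pseudo
`q`-commuting contractive lift coincides with any given such lift. -/
theorem IsPseudoQLift.eq_of_relations {q : ℂ} (hq : ‖q‖ = 1) {T₁ T₂ : H →L[ℂ] H} {P : H →ₗᵢ[ℂ] K}
    {W₁ W₂ W U₁ U₂ : K →L[ℂ] K} (h : IsPseudoQLift q T₁ T₂ P W₁ W₂ W)
    (hc₁ : ∀ x, U₁ (W x) = q • W (U₁ x)) (hc₂ : ∀ x, U₂ (W x) = (starRingEnd ℂ) q • W (U₂ x))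
    (hr : U₁ = (starRingEnd ℂ) q • (U₂.adjoint ∘L W))
    (hl₁ : ∀ x, P (T₁.adjoint x) = U₁.adjoint (P x))
    (hl₂ : ∀ x, P (T₂.adjoint x) = U₂.adjoint (P x)) : W₁ = U₁ ∧ W₂ = U₂ := by
  have hd₁ : ∀ x, W₁ (W x) = q • W (W₁ x) := fun x => DFunLike.congr_fun h.qcomm₁ x
  have hd₂ : ∀ x, W₂ (W x) = (starRingEnd ℂ) q • W (W₂ x) := fun x => DFunLike.congr_fun h.qcomm₂ x
  have := h.isMinimalIsometricLift.pair_eq_zero hq (X₁ := W₁ - U₁) (X₂ := W₂ - U₂)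
    (fun x => by rw [sub_apply, sub_apply, hd₁, hc₁, map_sub, smul_sub])
    (fun x => by rw [sub_apply, sub_apply, hd₂, hc₂, map_sub, smul_sub])
    (by rw [map_sub, ContinuousLinearMap.sub_comp, smul_sub, ← h.relation, ← hr])
    (fun x => by rw [map_sub, sub_apply, ← h.lift₁, ← hl₁, sub_self])
    (fun x => by rw [map_sub, sub_apply, ← h.lift₂, ← hl₂, sub_self])
  exact ⟨sub_eq_zero.1 this.1, sub_eq_zero.1 this.2⟩

/-- The operator `τ A τ*`. -/
def conjOp (τ : K ≃ₗᵢ[ℂ] K') (A : K →L[ℂ] K) : K' →L[ℂ] K' :=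
  τ.toContinuousLinearEquiv.toContinuousLinearMap ∘L A ∘L
    τ.symm.toContinuousLinearEquiv.toContinuousLinearMap

@[simp] theorem conjOp_apply (τ : K ≃ₗᵢ[ℂ] K') (A : K →L[ℂ] K) (x : K') :
    conjOp τ A x = τ (A (τ.symm x)) := rfl

theorem norm_conjOp_le {τ : K ≃ₗᵢ[ℂ] K'} {A : K →L[ℂ] K} (hA : ‖A‖ ≤ 1) : ‖conjOp τ A‖ ≤ 1 :=
  ContinuousLinearMap.opNorm_le_bound _ zero_le_one fun x => by
    rw [conjOp_apply, τ.norm_map, one_mul, ← τ.symm.norm_map x]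
    exact norm_apply_le hA _

theorem adjoint_conjOp (τ : K ≃ₗᵢ[ℂ] K') (A : K →L[ℂ] K) :
    (conjOp τ A).adjoint = conjOp τ A.adjoint := by
  symm
  rw [ContinuousLinearMap.eq_adjoint_iff]
  intro x y
  rw [conjOp_apply, conjOp_apply, τ.inner_map_eq_flip, ContinuousLinearMap.adjoint_inner_left,
    ← τ.inner_map_map, τ.apply_symm_apply]

/-- Moves the given lift onto the space of the model, so that it can be compared there with the
model pair. Minimality is taken as a hypothesis because it is known for the Douglas lift
independently. -/
theorem IsPseudoQLift.conj {q : ℂ} {T₁ T₂ : H →L[ℂ] H} {P : H →ₗᵢ[ℂ] K} {W₁ W₂ W : K →L[ℂ] K}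
    (h : IsPseudoQLift q T₁ T₂ P W₁ W₂ W) (τ : K ≃ₗᵢ[ℂ] K') {P' : H →ₗᵢ[ℂ] K'} {W' : K' →L[ℂ] K'}
    (hP : ∀ x, τ (P x) = P' x) (hW : ∀ x, τ (W x) = W' (τ x))
    (hmin : (⨆ n : ℕ, P'.toLinearMap.range.map (W' ^ n).toLinearMap).topologicalClosure = ⊤) :
    IsPseudoQLift q T₁ T₂ P' (conjOp τ W₁) (conjOp τ W₂) W' := by
  obtain rfl : W' = conjOp τ W := by
    ext1 x
    rw [conjOp_apply, hW, τ.apply_symm_apply]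
  have hP' : ∀ x, τ.symm (P' x) = P x := fun x => by rw [← hP, τ.symm_apply_apply]
  refine ⟨⟨norm_conjOp_le h.contraction₁, norm_conjOp_le h.contraction₂, fun x => ?_, ?_, ?_, ?_⟩,
    fun x => ?_, fun x => ?_, fun x => ?_, hmin⟩
  · rw [conjOp_apply, τ.norm_map, h.isometry, τ.symm.norm_map]
  · ext1 x
    have := DFunLike.congr_fun h.qcomm₁ (τ.symm x)
    simp only [ContinuousLinearMap.comp_apply, smul_apply] at this
    simp [this]
  · ext1 x
    have := DFunLike.congr_fun h.qcomm₂ (τ.symm x)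
    simp only [ContinuousLinearMap.comp_apply, smul_apply] at this
    simp [this]
  · ext1 x
    have := DFunLike.congr_fun h.relation (τ.symm x)
    simp only [ContinuousLinearMap.comp_apply, smul_apply] at this
    simp [this, adjoint_conjOp]
  · rw [adjoint_conjOp, conjOp_apply, hP', ← h.lift₁, hP]
  · rw [adjoint_conjOp, conjOp_apply, hP', ← h.lift₂, hP]
  · rw [adjoint_conjOp, conjOp_apply, hP', ← h.lift, hP]

end MinimalLift

/-! ### Coefficient formulas for operators on the Hardy space and their adjoints. -/

section HardyAdjoint

variable {E : Type*} [NormedAddCommGroup E] [InnerProductSpace ℂ E] [CompleteSpace E]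

/-- Pairing with the monomials `zⁿ x` reads off the `n`-th coefficient; adjoints below are computed
this way. -/
theorem Hardy.apply_eq_of_inner {f : Hardy E} {n : ℕ} {y : E}
    (h : ∀ x, inner ℂ (lp.single 2 n x : Hardy E) f = inner ℂ x y) : f n = y :=
  ext_inner_left ℂ fun x => (lp.inner_single_left n x f).symm.trans (h x)

theorem hardyMap_adjoint (A : E →L[ℂ] E) : (hardyMap A).adjoint = hardyMap A.adjoint := by
  symm
  rw [ContinuousLinearMap.eq_adjoint_iff]
  refine fun f g => (lp.hasSum_inner (𝕜 := ℂ) (hardyMap A.adjoint f) g).unique ?_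
  refine (lp.hasSum_inner (𝕜 := ℂ) f (hardyMap A g)).congr_fun fun n => ?_
  rw [hardyMap_apply, hardyMap_apply, ContinuousLinearMap.adjoint_inner_left]

theorem shift_single (n : ℕ) (x : E) :
    shift E (lp.single 2 n x) = (lp.single 2 (n + 1) x : Hardy E) := by
  refine lp.ext (funext fun k => ?_)
  cases k with
  | zero => simp [lp.single_apply]
  | succ k => simp [lp.single_apply, Pi.single_apply]

theorem shift_adjoint_apply (f : Hardy E) (n : ℕ) : (shift E).adjoint f n = f (n + 1) := by
  refine Hardy.apply_eq_of_inner fun x => ?_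
  rw [ContinuousLinearMap.adjoint_inner_right, shift_single]
  exact lp.inner_single_left (𝕜 := ℂ) (G := fun _ : ℕ => E) (n + 1) x f

theorem rotation_adjoint_apply {q : ℂ} (hq : ‖q‖ = 1) (f : Hardy E) (n : ℕ) :
    (rotation E hq).adjoint f n = (starRingEnd ℂ) q ^ n • f n := by
  refine Hardy.apply_eq_of_inner fun x => ?_
  have hs : rotation E hq (lp.single 2 n x) = q ^ n • (lp.single 2 n x : Hardy E) := by
    refine lp.ext (funext fun k => ?_)
    rw [rotation_apply, lp.coeFn_smul, Pi.smul_apply]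
    by_cases hk : k = n
    · rw [hk]
    · simp [lp.single_apply, hk]
  rw [ContinuousLinearMap.adjoint_inner_right, hs, inner_smul_left, inner_smul_right, map_pow]
  congr 1
  exact lp.inner_single_left (𝕜 := ℂ) (G := fun _ : ℕ => E) n x f

theorem mulPencil_apply_zero (A B : E →L[ℂ] E) (f : Hardy E) : mulPencil A B f 0 = A (f 0) := by
  simp [mulPencil]

theorem mulPencil_apply_succ (A B : E →L[ℂ] E) (f : Hardy E) (n : ℕ) :
    mulPencil A B f (n + 1) = A (f (n + 1)) + B (f n) := by
  simp [mulPencil]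

theorem mulPencil_adjoint_apply (A B : E →L[ℂ] E) (f : Hardy E) (n : ℕ) :
    (mulPencil A B).adjoint f n = A.adjoint (f n) + B.adjoint (f (n + 1)) := by
  rw [mulPencil, map_add, ContinuousLinearMap.adjoint_comp, hardyMap_adjoint, hardyMap_adjoint]
  change A.adjoint (f n) + B.adjoint ((shift E).adjoint f n) = _
  rw [shift_adjoint_apply]

/-- Multiplication by the pencil commutes with `M_z`, so the factor comes from `R_q M_z = q M_z R_q`
alone. -/
theorem mulPencil_rotation_shift (A B : E →L[ℂ] E) {q : ℂ} (hq : ‖q‖ = 1) (f : Hardy E) :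
    mulPencil A B (rotation E hq (shift E f)) = q • shift E (mulPencil A B (rotation E hq f)) := by
  refine lp.ext (funext fun n => ?_)
  rw [lp.coeFn_smul, Pi.smul_apply]
  -- Both the pencil and the shift look one coefficient back, so the indices `0` and `1` are
  -- boundary cases.
  rcases n with _ | _ | n
  · simp [mulPencil_apply_zero]
  · simp [mulPencil_apply_zero, mulPencil_apply_succ]
  · simp [mulPencil_apply_succ, smul_smul, pow_succ']

theorem rotation_mulPencil_shift (A B : E →L[ℂ] E) {q : ℂ} (hq : ‖q‖ = 1) (f : Hardy E) :
    rotation E hq (mulPencil A B (shift E f)) = q • shift E (rotation E hq (mulPencil A B f)) := by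
  refine lp.ext (funext fun n => ?_)
  rw [lp.coeFn_smul, Pi.smul_apply]
  rcases n with _ | _ | n
  · simp [mulPencil_apply_zero]
  · simp [mulPencil_apply_zero, mulPencil_apply_succ]
  · simp [mulPencil_apply_succ, smul_smul, pow_succ']

/-- The Hardy part of `W₁ = q̄ W₂* W`. The adjoint of the pencil `B* + zA` is `B` plus `A*` times
the backward shift; composed with `M_z` it becomes `A* + zB`. -/
theorem mulPencil_rotation_eq (A B : E →L[ℂ] E) {q : ℂ} (hq : ‖q‖ = 1)
    (hq' : ‖(starRingEnd ℂ) q‖ = 1) (f : Hardy E) :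
    mulPencil A.adjoint B (rotation E hq f) = (starRingEnd ℂ) q •
      (rotation E hq' ∘L mulPencil B.adjoint A).adjoint (shift E f) := by
  have h1 := mul_conj_eq_one hq
  refine lp.ext (funext fun n => ?_)
  rw [ContinuousLinearMap.adjoint_comp, lp.coeFn_smul, Pi.smul_apply,
    ContinuousLinearMap.comp_apply, mulPencil_adjoint_apply, rotation_adjoint_apply,
    rotation_adjoint_apply, ContinuousLinearMap.adjoint_adjoint, Complex.conj_conj, shift_apply_succ]
  -- The forward shift acts before the adjoint rotation, so `fₙ` picks up `qⁿ⁺¹`; the scalar `q̄`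
  -- removes the extra factor.
  have h2 : ∀ n, (starRingEnd ℂ) q * q ^ (n + 1) = q ^ n := fun n => by
    rw [pow_succ, mul_comm, mul_assoc, h1, mul_one]
  cases n with
  | zero =>
    simp only [mulPencil_apply_zero, rotation_apply, shift_apply_zero, smul_zero, map_zero, zero_add,
      map_smul, smul_smul, h2]
  | succ n =>
    simp only [mulPencil_apply_succ, rotation_apply, shift_apply_succ, smul_add, map_smul,
      smul_smul, h2]
    exact add_comm _ _

end HardyAdjoint

/-! ### Block-diagonal operators and closed invariant subspaces of a direct sum. -/

section BlockDiag

variable {E F : Type*} [NormedAddCommGroup E] [InnerProductSpace ℂ E] [CompleteSpace E]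
  [NormedAddCommGroup F] [InnerProductSpace ℂ F] [CompleteSpace F]

theorem blockDiag_adjoint (A : E →L[ℂ] E) (B : F →L[ℂ] F) :
    (blockDiag A B).adjoint = blockDiag A.adjoint B.adjoint := by
  symm
  rw [ContinuousLinearMap.eq_adjoint_iff]
  intro x y
  rw [WithLp.prod_inner_apply, WithLp.prod_inner_apply]
  change inner ℂ (A.adjoint x.fst) y.fst + inner ℂ (B.adjoint x.snd) y.snd
    = inner ℂ x.fst (A y.fst) + inner ℂ x.snd (B y.snd)
  rw [ContinuousLinearMap.adjoint_inner_left, ContinuousLinearMap.adjoint_inner_left]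

/-- The inclusion of the first summand. -/
def inlL (E F : Type*) [NormedAddCommGroup E] [InnerProductSpace ℂ E]
    [NormedAddCommGroup F] [InnerProductSpace ℂ F] : E →L[ℂ] WithLp 2 (E × F) :=
  (WithLp.prodContinuousLinearEquiv 2 ℂ E F).symm.toContinuousLinearMap ∘L
    ContinuousLinearMap.inl ℂ E F

/-- The inclusion of the second summand. -/
def inrL (E F : Type*) [NormedAddCommGroup E] [InnerProductSpace ℂ E]
    [NormedAddCommGroup F] [InnerProductSpace ℂ F] : F →L[ℂ] WithLp 2 (E × F) :=
  (WithLp.prodContinuousLinearEquiv 2 ℂ E F).symm.toContinuousLinearMap ∘L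
    ContinuousLinearMap.inr ℂ E F

theorem blockDiag_inlL (A : E →L[ℂ] E) (B : F →L[ℂ] F) (x : E) :
    blockDiag A B (inlL E F x) = inlL E F (A x) :=
  WithLp.ofLp_injective 2 (Prod.ext rfl (map_zero B))

theorem blockDiag_inrL (A : E →L[ℂ] E) (B : F →L[ℂ] F) (y : F) :
    blockDiag A B (inrL E F y) = inrL E F (B y) :=
  WithLp.ofLp_injective 2 (Prod.ext (map_zero A) rfl)

theorem inlL_add_inrL (x : E) (y : F) :
    inlL E F x + inrL E F y = WithLp.toLp 2 (x, y) :=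
  WithLp.ofLp_injective 2 (Prod.ext (add_zero x) (zero_add y))

theorem mem_of_denseRange {ι : Type*} {g : ι → E} (hg : DenseRange g) {S : Submodule ℂ F}
    (hS : IsClosed (S : Set F)) (A : E →L[ℂ] F) (h : ∀ i, A (g i) ∈ S) (x : E) : A x ∈ S :=
  hg.induction_on (p := fun x => A x ∈ S) x (hS.preimage A.continuous) h

/-- A closed subspace that is invariant under `M_z ⊕ W` and contains the constants contains
`H²(E) ⊕ 0`. -/
theorem inlL_mem_of_shift_invariant {W : F →L[ℂ] F} {S : Submodule ℂ (WithLp 2 (Hardy E × F))}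
    (hS : IsClosed (S : Set (WithLp 2 (Hardy E × F))))
    (hV : ∀ x ∈ S, blockDiag (shift E) W x ∈ S)
    (h0 : ∀ x : E, inlL (Hardy E) F (lp.single 2 0 x) ∈ S) (f : Hardy E) :
    inlL (Hardy E) F f ∈ S := by
  have hn : ∀ n (x : E), inlL (Hardy E) F (lp.single 2 n x) ∈ S := fun n => by
    induction n with
    | zero => exact h0
    | succ n ih =>
      intro x
      rw [← shift_single, ← blockDiag_inlL _ W]
      exact hV _ (ih x)
  have h := (lp.hasSum_single (by norm_num) f).mapL (inlL (Hardy E) F)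
  exact hS.mem_of_tendsto h (Filter.Eventually.of_forall fun s =>
    Submodule.sum_mem _ fun n _ => hn n _)

/-- The counterpart of `inlL_mem_of_shift_invariant`: here the image of `ι` plays the role of the
constants, and minimality of `W` that of the density of polynomials. -/
theorem IsMinimalUnitaryExtension.inrL_mem {D : Type*} [NormedAddCommGroup D]
    [InnerProductSpace ℂ D] [CompleteSpace D] {v : D →L[ℂ] D} {ι : D →ₗᵢ[ℂ] F} {W : F →L[ℂ] F}
    (h : IsMinimalUnitaryExtension v ι W) {A : E →L[ℂ] E} {S : Submodule ℂ (WithLp 2 (E × F))}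
    (hS : IsClosed (S : Set (WithLp 2 (E × F)))) (hV : ∀ x ∈ S, blockDiag A W x ∈ S)
    (h0 : ∀ d, inrL E F (ι d) ∈ S) (y : F) : inrL E F y ∈ S := by
  have hn : ∀ n d, inrL E F ((W ^ n) (ι d)) ∈ S := fun n => by
    induction n with
    | zero => exact h0
    | succ n ih =>
      intro d
      rw [pow_succ_apply, ← blockDiag_inrL A]
      exact hV _ (ih d)
  have hle : (⨆ n : ℕ, ι.toLinearMap.range.map (W ^ n).toLinearMap)
      ≤ S.comap (inrL E F).toLinearMap := by
    refine iSup_le fun n => ?_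
    rintro _ ⟨_, ⟨d, rfl⟩, rfl⟩
    exact hn n d
  have := Submodule.topologicalClosure_minimal _ hle (hS.preimage (inrL E F).continuous)
  rw [h.minimal, top_le_iff] at this
  have hy : y ∈ S.comap (inrL E F).toLinearMap := this ▸ Submodule.mem_top
  exact hy

end BlockDiag

/-! ### Minimality of the Douglas isometric lift, in abstract form. -/

section ModelEmbedding

variable {H E F D : Type*} [NormedAddCommGroup H] [InnerProductSpace ℂ H] [CompleteSpace H]
  [NormedAddCommGroup E] [InnerProductSpace ℂ E] [CompleteSpace E]
  [NormedAddCommGroup F] [InnerProductSpace ℂ F] [CompleteSpace F]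
  [NormedAddCommGroup D] [InnerProductSpace ℂ D] [CompleteSpace D]

theorem norm_shift (f : Hardy E) : ‖shift E f‖ = ‖f‖ := by
  rw [← sq_eq_sq₀ (norm_nonneg _) (norm_nonneg _)]
  exact (Hardy.hasSum_sq (shift E f)).unique (Hardy.hasSum_shift f)

/-- `P x = 𝒪 x ⊕ ι (r x)`, where `(𝒪 x)ₙ = d (T*ⁿ x)`, the maps `d`, `r` have dense range, and `W` is
the minimal unitary extension of the isometry induced by `T*` along `r`. -/
structure IsModelEmbedding (T : H →L[ℂ] H) (d : H →L[ℂ] E) (O : H →L[ℂ] Hardy E) (r : H →L[ℂ] D)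
    (v : D →L[ℂ] D) (ι : D →ₗᵢ[ℂ] F) (W : F →L[ℂ] F) (P : H →ₗᵢ[ℂ] WithLp 2 (Hardy E × F)) :
    Prop where
  eq_add : ∀ x, P x = inlL _ _ (O x) + inrL _ _ (ι (r x))
  coeff : ∀ x n, O x n = d ((T.adjoint ^ n) x)
  dense_d : DenseRange d
  dense_r : DenseRange r
  induced : ∀ x, v (r x) = r (T.adjoint x)
  unitary_ext : IsMinimalUnitaryExtension v ι W

namespace IsModelEmbedding

variable {T : H →L[ℂ] H} {d : H →L[ℂ] E} {O : H →L[ℂ] Hardy E} {r : H →L[ℂ] D} {v : D →L[ℂ] D}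
  {ι : D →ₗᵢ[ℂ] F} {W : F →L[ℂ] F} {P : H →ₗᵢ[ℂ] WithLp 2 (Hardy E × F)}

/-- Used with adjoint operators for `A` and `B`, it reduces each lifting identity to one identity
per summand. -/
theorem intertwine (h : IsModelEmbedding T d O r v ι W P) {x y : H} {A : Hardy E →L[ℂ] Hardy E}
    {B : F →L[ℂ] F} (h₁ : O y = A (O x)) (h₂ : ι (r y) = B (ι (r x))) :
    P y = blockDiag A B (P x) := by
  rw [h.eq_add, h.eq_add, map_add, blockDiag_inlL, blockDiag_inrL, h₁, h₂]

theorem coeff_adjoint (h : IsModelEmbedding T d O r v ι W P) (x : H) (n : ℕ) :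
    O (T.adjoint x) n = O x (n + 1) := by
  rw [h.coeff, h.coeff, pow_succ]; rfl

/-- The key to minimality. In the Hardy summand the coefficients telescope to the constant term; in
the other summand `W ι r T* x = W W* ι r x = ι r x`, so the difference vanishes. -/
theorem sub_eq (h : IsModelEmbedding T d O r v ι W P) (x : H) :
    P x - blockDiag (shift E) W (P (T.adjoint x)) = inlL _ _ (lp.single 2 0 (d x)) := by
  obtain ⟨-, hWW⟩ := h.unitary_ext.unitary_facts
  have hs : O x - shift E (O (T.adjoint x)) = lp.single 2 0 (d x) := by
    refine lp.ext (funext fun n => ?_)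
    rw [lp.coeFn_sub, Pi.sub_apply]
    cases n with
    | zero => rw [shift_apply_zero, h.coeff, sub_zero]; simp
    | succ n => rw [shift_apply_succ, h.coeff_adjoint, sub_self]; simp [lp.single_apply]
  rw [← hs, h.eq_add, h.eq_add, map_add, blockDiag_inlL, blockDiag_inrL, ← h.induced,
    ← h.unitary_ext.extends', hWW, map_sub]
  abel

theorem isometry (h : IsModelEmbedding T d O r v ι W P) (x : WithLp 2 (Hardy E × F)) :
    ‖blockDiag (shift E) W x‖ = ‖x‖ := by
  rw [← sq_eq_sq₀ (norm_nonneg _) (norm_nonneg _), WithLp.prod_norm_sq_eq_of_L2,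
    WithLp.prod_norm_sq_eq_of_L2]
  change ‖shift E x.fst‖ ^ 2 + ‖W x.snd‖ ^ 2 = ‖x.fst‖ ^ 2 + ‖x.snd‖ ^ 2
  rw [norm_shift, ContinuousLinearMap.norm_map_of_mem_unitary h.unitary_ext.mem_unitary]

theorem isMinimalIsometricLift (h : IsModelEmbedding T d O r v ι W P) :
    IsMinimalIsometricLift T P (blockDiag (shift E) W) := by
  refine ⟨h.isometry, fun x => ?_, ?_⟩
  · rw [blockDiag_adjoint]
    refine h.intertwine (lp.ext (funext fun n => ?_)) ?_
    · rw [shift_adjoint_apply, h.coeff_adjoint]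
    · rw [h.unitary_ext.extends', h.induced]
  set V := blockDiag (shift E) W with hV
  -- From here on `S` enters only as a closed, `V`-invariant subspace containing the orbit of `P H`.
  generalize hS : (⨆ n : ℕ, P.toLinearMap.range.map (V ^ n).toLinearMap).topologicalClosure = S
  have hcl : IsClosed (S : Set (WithLp 2 (Hardy E × F))) := by
    rw [← hS]; exact Submodule.isClosed_topologicalClosure _
  have hPn : ∀ n x, (V ^ n) (P x) ∈ S := fun n x => by
    rw [← hS]
    exact Submodule.le_topologicalClosure _ (Submodule.mem_iSup_of_mem n ⟨_, ⟨x, rfl⟩, rfl⟩)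
  have hVS : ∀ x ∈ S, V x ∈ S := by
    have : S ≤ S.comap V.toLinearMap := by
      conv_lhs => rw [← hS]
      refine Submodule.topologicalClosure_minimal _ (iSup_le fun n => ?_)
        (hcl.preimage V.continuous)
      rintro _ ⟨_, ⟨x, rfl⟩, rfl⟩
      change V ((V ^ n) (P x)) ∈ S
      rw [← pow_succ_apply]
      exact hPn (n + 1) x
    exact this
  -- Vectors `P x - V P T* x` supply the constants `d x`; the dense range of `d` gives all
  -- constants.
  have h0 : ∀ e, inlL _ F (lp.single 2 0 e : Hardy E) ∈ S :=
    mem_of_denseRange h.dense_d hcl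
      (inlL _ F ∘L lp.singleContinuousLinearMap ℂ (fun _ : ℕ => E) 2 0) fun x => by
        change inlL _ F (lp.single 2 0 (d x) : Hardy E) ∈ S
        rw [← h.sub_eq]
        exact S.sub_mem (hPn 0 x) (hVS _ (hPn 0 _))
  have hl := inlL_mem_of_shift_invariant hcl hVS h0
  -- With the Hardy summand already inside `S`, subtracting `𝒪 x` from `P x` isolates `ι (r x)`.
  have hr := h.unitary_ext.inrL_mem hcl hVS
    (mem_of_denseRange h.dense_r hcl (inrL (Hardy E) F ∘L ι.toContinuousLinearMap) fun x => by
        have := S.sub_mem (hPn 0 x) (hl (O x))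
        rw [pow_zero, one_apply_eq_self, h.eq_add, add_sub_cancel_left] at this
        exact this)
  refine eq_top_iff.2 fun x _ => ?_
  have := S.add_mem (hl x.fst) (hr x.snd)
  rwa [inlL_add_inrL] at this

end IsModelEmbedding

end ModelEmbedding

theorem douglas_isModelEmbedding {H : Type*} [NormedAddCommGroup H] [InnerProductSpace ℂ H]
    [CompleteSpace H] {T : H →L[ℂ] H} (hT : ‖T‖ ≤ 1) :
    IsModelEmbedding T (toRangeClosure (defect T.adjoint)) (observability T hT)
      (toRangeClosure (asymptoticRoot T hT)) (asymptoticIsometry T hT)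
      (uextIncl (asymptoticIsometry T hT)) (douglasUnitary T hT) (douglasEmbedding T hT) where
  eq_add x := (inlL_add_inrL (E := Hardy (DefectSpace T.adjoint)) (F := QSpace T hT)
    (observability T hT x)
    (uextIncl (asymptoticIsometry T hT) (toRangeClosure (asymptoticRoot T hT) x))).symm
  coeff _ _ := rfl
  dense_d := denseRange_toRangeClosure _
  dense_r := denseRange_toRangeClosure _
  induced := asymptoticIsometry_apply hT
  unitary_ext := douglasUnitary_isMinimal hT

/-! ### Relations on direct sums and for the canonical unitary pair. -/

section Relations

variable {E F : Type*} [NormedAddCommGroup E] [InnerProductSpace ℂ E] [CompleteSpace E]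
  [NormedAddCommGroup F] [InnerProductSpace ℂ F] [CompleteSpace F]

theorem blockDiag_scaled_comm {A V : E →L[ℂ] E} {B W : F →L[ℂ] F} {c : ℂ}
    (hA : ∀ x, A (V x) = c • V (A x)) (hB : ∀ x, B (W x) = c • W (B x)) (x : WithLp 2 (E × F)) :
    blockDiag A B (blockDiag V W x) = c • blockDiag V W (blockDiag A B x) :=
  WithLp.ofLp_injective 2 (Prod.ext (hA x.fst) (hB x.snd))

theorem blockDiag_relation {A₁ A₂ V : E →L[ℂ] E} {B₁ B₂ W : F →L[ℂ] F} {c : ℂ}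
    (hA : ∀ x, A₁ x = c • A₂.adjoint (V x)) (hB : ∀ x, B₁ x = c • B₂.adjoint (W x)) :
    blockDiag A₁ B₁ = c • ((blockDiag A₂ B₂).adjoint ∘L blockDiag V W) := by
  rw [blockDiag_adjoint]
  exact ContinuousLinearMap.ext fun x =>
    WithLp.ofLp_injective 2 (Prod.ext (hA x.fst) (hB x.snd))

variable {D : Type*} [NormedAddCommGroup D] [InnerProductSpace ℂ D] [CompleteSpace D]

/-- Taking adjoints in `U₁* U₂* = q W*` gives `U₂ U₁ = q̄ W`, hence `W = U₁ U₂`. The commutation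
relations then follow by reassociating, and the last identity by cancelling `U₂* U₂`. -/
theorem IsCanonicalExtension.relations {q : ℂ} (hq : ‖q‖ = 1) {ι : D →ₗᵢ[ℂ] F} {V₁ V₂ : D →L[ℂ] D}
    {W : F →L[ℂ] F} {U : (F →L[ℂ] F) × (F →L[ℂ] F)} (h : IsCanonicalExtension q ι V₁ V₂ W U) :
    (∀ x, U.1 (W x) = q • W (U.1 x)) ∧ (∀ x, U.2 (W x) = (starRingEnd ℂ) q • W (U.2 x)) ∧
      ∀ x, U.1 x = (starRingEnd ℂ) q • U.2.adjoint (W x) := by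
  obtain ⟨-, hu, hc, -, -, hp⟩ := h
  have hq1 := mul_conj_eq_one hq
  have hc' : ∀ x, U.1 (U.2 x) = q • U.2 (U.1 x) := fun x => DFunLike.congr_fun hc x
  have h21 : ∀ x, U.2 (U.1 x) = (starRingEnd ℂ) q • W x := fun x => by
    have := congrArg ContinuousLinearMap.adjoint hp
    rw [ContinuousLinearMap.adjoint_comp, map_smulₛₗ, ContinuousLinearMap.adjoint_adjoint,
      ContinuousLinearMap.adjoint_adjoint, ContinuousLinearMap.adjoint_adjoint] at this
    exact DFunLike.congr_fun this x
  have h12 : ∀ x, W x = U.1 (U.2 x) := fun x => by rw [hc', h21, smul_smul, hq1, one_smul]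
  have ha : ∀ x, U.2.adjoint (U.2 x) = x := fun x => DFunLike.congr_fun (Unitary.mem_iff.1 hu).1 x
  refine ⟨fun x => ?_, fun x => ?_, fun x => ?_⟩
  · rw [h12 x, hc' x, map_smul, h12 (U.1 x)]
  · rw [h12 x, h21]
  · rw [← map_smul, ← h21, ha]

theorem IsCanonicalExtension.adjoint_apply {q : ℂ} {ι : D →ₗᵢ[ℂ] F} {V₁ V₂ : D →L[ℂ] D}
    {W : F →L[ℂ] F} {U : (F →L[ℂ] F) × (F →L[ℂ] F)} (h : IsCanonicalExtension q ι V₁ V₂ W U) (x : D) :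
    U.1.adjoint (ι x) = ι (V₁ x) ∧ U.2.adjoint (ι x) = ι (V₂ x) :=
  ⟨h.2.2.2.1 x, h.2.2.2.2.1 x⟩

end Relations

/-! ### Defect identities for the fundamental operators. -/

section Pair

variable {H : Type*} [NormedAddCommGroup H] [InnerProductSpace ℂ H] [CompleteSpace H]
  {q : ℂ} {T₁ T₂ : H →L[ℂ] H}

/-- A symmetric operator is injective on the closure of its range, the kernel being orthogonal to
the range. -/
theorem eq_of_apply_eq {D : H →L[ℂ] H} (hD : ∀ x y, inner ℂ (D x) y = inner ℂ x (D y))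
    {u v : RangeClosure D} (h : D u = D v) : u = v := by
  refine ext_inner_right ℂ fun w => ?_
  refine (denseRange_toRangeClosure D).induction_on (p := fun w => inner ℂ u w = inner ℂ v w) w
    (isClosed_eq (continuous_const.inner continuous_id) (continuous_const.inner continuous_id))
    fun y => ?_
  change inner ℂ (u : H) (D y) = inner ℂ (v : H) (D y)
  rw [← hD, ← hD, h]

theorem sandwich_adjoint {D A : H →L[ℂ] H} (hD : ∀ x y, inner ℂ (D x) y = inner ℂ x (D y))
    {G : RangeClosure D →L[ℂ] RangeClosure D} (hG : ∀ x, D (G (toRangeClosure D x)) = A x) (x : H) :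
    D (G.adjoint (toRangeClosure D x)) = A.adjoint x := by
  refine ext_inner_right ℂ fun y => ?_
  rw [hD, ContinuousLinearMap.adjoint_inner_left, ← hG, ← hD x]
  change inner ℂ (G.adjoint (toRangeClosure D x)) (toRangeClosure D y)
    = inner ℂ (toRangeClosure D x) (G (toRangeClosure D y))
  rw [ContinuousLinearMap.adjoint_inner_left]

/-- Since `D` can be cancelled on the closure of its range, it suffices to compare after applying
`D` once more. Then `D² = I - T T*` and the sandwich equations leave only `hAB`, an identity on `H`.
The form serves both fundamental operators, with their roles exchanged and `c` equal to `1` or `q`.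
-/
theorem sandwich_defect_eq {D S A B T : H →L[ℂ] H} {c : ℂ}
    (hD : ∀ x y, inner ℂ (D x) y = inner ℂ x (D y)) (hDD : ∀ x, D (D x) = x - T (T.adjoint x))
    {G G' : RangeClosure D →L[ℂ] RangeClosure D}
    (hG : ∀ x, D (G (toRangeClosure D x)) = A x) (hG' : ∀ x, D (G' (toRangeClosure D x)) = B x)
    (hAB : ∀ x, A x + c • B.adjoint (T.adjoint x) = S x - T (T.adjoint (S x))) (x : H) :
    toRangeClosure D (S x) = G (toRangeClosure D x)
      + c • G'.adjoint (toRangeClosure D (T.adjoint x)) := by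
  refine eq_of_apply_eq hD ?_
  rw [Submodule.coe_add, Submodule.coe_smul, map_add, map_smul, hG, sandwich_adjoint hD hG', hAB,
    coe_toRangeClosure, hDD]

theorem IsQCommutingContractivePair.adj_comm₁ (h : IsQCommutingContractivePair q T₁ T₂) (x : H) :
    (T₁ ∘L T₂).adjoint (T₁.adjoint x)
      = (starRingEnd ℂ) q • T₁.adjoint ((T₁ ∘L T₂).adjoint x) := by
  rw [h.adj_apply, h.adj_apply, h.adj_qcomm, smul_smul, mul_comm, mul_conj_eq_one h.norm_q,
    one_smul]

theorem IsQCommutingContractivePair.adj_comm₂ (h : IsQCommutingContractivePair q T₁ T₂) (x : H) :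
    (T₁ ∘L T₂).adjoint (T₂.adjoint x) = q • T₂.adjoint ((T₁ ∘L T₂).adjoint x) := by
  rw [h.adj_apply, h.adj_apply, h.adj_qcomm, map_smul]

theorem defect_adjoint_symm (T : H →L[ℂ] H) (x y : H) :
    inner ℂ (defect T.adjoint x) y = inner ℂ x (defect T.adjoint y) := sqrt_inner _ x y

theorem defect_adjoint_apply {T : H →L[ℂ] H} (hT : ‖T‖ ≤ 1) (x : H) :
    defect T.adjoint (defect T.adjoint x) = x - T (T.adjoint x) := by
  rw [defect_apply_apply (norm_adjoint_le hT), ContinuousLinearMap.adjoint_adjoint]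

/-- `D T₁* = G₁ D + G₂* D T*`, where `D = D_{T*}`. -/
theorem fundamentalPair_defect₁ (h : IsQCommutingContractivePair q T₁ T₂) (x : H) :
    toRangeClosure (defect (T₁ ∘L T₂).adjoint) (T₁.adjoint x)
      = (fundamentalPair h).1 (toRangeClosure (defect (T₁ ∘L T₂).adjoint) x)
        + (1 : ℂ) • (fundamentalPair h).2.adjoint
          (toRangeClosure (defect (T₁ ∘L T₂).adjoint) ((T₁ ∘L T₂).adjoint x)) :=
  sandwich_defect_eq (A := T₁.adjoint - T₂ ∘L (T₁ ∘L T₂).adjoint)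
    (B := T₂.adjoint - q • (T₁ ∘L (T₁ ∘L T₂).adjoint)) (defect_adjoint_symm (T₁ ∘L T₂))
    (defect_adjoint_apply h.norm_prod) (fundamentalPair_spec h).1 (fundamentalPair_spec h).2
    -- The terms `∓ T₂ T*` cancel, and `T* T₁* = q̄ T₁* T*` matches what is left.
    (fun x => by
      rw [h.adj_comm₁, map_sub, map_smulₛₗ, ContinuousLinearMap.adjoint_comp T₁ (T₁ ∘L T₂).adjoint,
        ContinuousLinearMap.adjoint_adjoint, ContinuousLinearMap.adjoint_adjoint, one_smul, map_smul]
      simp only [sub_apply, smul_apply, ContinuousLinearMap.comp_apply]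
      abel) x

/-- `D T₂* = G₂ D + q G₁* D T*`, where `D = D_{T*}`. -/
theorem fundamentalPair_defect₂ (h : IsQCommutingContractivePair q T₁ T₂) (x : H) :
    toRangeClosure (defect (T₁ ∘L T₂).adjoint) (T₂.adjoint x)
      = (fundamentalPair h).2 (toRangeClosure (defect (T₁ ∘L T₂).adjoint) x)
        + q • (fundamentalPair h).1.adjoint
          (toRangeClosure (defect (T₁ ∘L T₂).adjoint) ((T₁ ∘L T₂).adjoint x)) :=
  sandwich_defect_eq (A := T₂.adjoint - q • (T₁ ∘L (T₁ ∘L T₂).adjoint))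
    (B := T₁.adjoint - T₂ ∘L (T₁ ∘L T₂).adjoint) (defect_adjoint_symm (T₁ ∘L T₂))
    (defect_adjoint_apply h.norm_prod) (fundamentalPair_spec h).2 (fundamentalPair_spec h).1
    -- With `c = q` the terms `∓ q T₁ T*` cancel, and `T* T₂* = q T₂* T*` matches what is left.
    (fun x => by
      rw [h.adj_comm₂, map_sub, ContinuousLinearMap.adjoint_comp T₂ (T₁ ∘L T₂).adjoint,
        ContinuousLinearMap.adjoint_adjoint, ContinuousLinearMap.adjoint_adjoint, map_smul]
      simp only [sub_apply, smul_apply, ContinuousLinearMap.comp_apply, smul_sub]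
      abel) x

end Pair

/-! ### Intertwining of the observability operator with the model operators. -/

section ModelIntertwining

variable {H E : Type*} [NormedAddCommGroup H] [InnerProductSpace ℂ H] [CompleteSpace H]
  [NormedAddCommGroup E] [InnerProductSpace ℂ E] [CompleteSpace E]
  {T S : H →L[ℂ] H} {d : H →L[ℂ] E} {O : H →L[ℂ] Hardy E} {A B : E →L[ℂ] E} {q : ℂ}

theorem scaled_pow_comm {X Y : H →L[ℂ] H} {c : ℂ} (h : ∀ x, X (Y x) = c • Y (X x)) (n : ℕ) (x : H) :
    (X ^ n) (Y x) = c ^ n • Y ((X ^ n) x) := by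
  induction n with
  | zero => simp
  | succ n ih => rw [pow_succ_apply, ih, map_smul, h, smul_smul, pow_succ_apply, pow_succ]

/-- In the `n`-th coefficient, moving `S` past `T*ⁿ` costs `q̄ⁿ`, the factor by which the adjoint
rotation acts there; `hd` at `T*ⁿ x` then gives the two terms of the adjoint pencil. -/
theorem mulPencil_rotation_adjoint_intertwine (hO : ∀ x n, O x n = d ((T.adjoint ^ n) x))
    (hq : ‖q‖ = 1) (hc : ∀ x, T.adjoint (S x) = (starRingEnd ℂ) q • S (T.adjoint x))
    (hd : ∀ x, d (S x) = A (d x) + (1 : ℂ) • B.adjoint (d (T.adjoint x))) (x : H) :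
    O (S x) = (mulPencil A.adjoint B ∘L rotation E hq).adjoint (O x) := by
  refine lp.ext (funext fun n => ?_)
  rw [ContinuousLinearMap.adjoint_comp, ContinuousLinearMap.comp_apply, rotation_adjoint_apply,
    mulPencil_adjoint_apply, hO, hO, hO, scaled_pow_comm hc, map_smul, hd, one_smul,
    ContinuousLinearMap.adjoint_adjoint, pow_succ_apply]

/-- Here the adjoint rotation acts before the backward shift, so the coefficient of index `n + 1`
carries `qⁿ⁺¹`. This explains the scalar `q` in `hd`, absent from the first intertwining. -/
theorem rotation_mulPencil_adjoint_intertwine (hO : ∀ x n, O x n = d ((T.adjoint ^ n) x))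
    (hq' : ‖(starRingEnd ℂ) q‖ = 1) (hc : ∀ x, T.adjoint (S x) = q • S (T.adjoint x))
    (hd : ∀ x, d (S x) = B (d x) + q • A.adjoint (d (T.adjoint x))) (x : H) :
    O (S x) = (rotation E hq' ∘L mulPencil B.adjoint A).adjoint (O x) := by
  refine lp.ext (funext fun n => ?_)
  rw [ContinuousLinearMap.adjoint_comp, ContinuousLinearMap.comp_apply, mulPencil_adjoint_apply,
    rotation_adjoint_apply, rotation_adjoint_apply, hO, hO, hO, scaled_pow_comm hc, map_smul, hd,
    ContinuousLinearMap.adjoint_adjoint, pow_succ_apply, Complex.conj_conj, smul_add, map_smul,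
    map_smul, smul_smul, pow_succ]

end ModelIntertwining

/-! ### The Douglas model satisfies the algebraic relations of a pseudo lift. -/

section Douglas

variable {H : Type*} [NormedAddCommGroup H] [InnerProductSpace ℂ H] [CompleteSpace H]
  {q : ℂ} {T₁ T₂ : H →L[ℂ] H}

theorem douglasEmbedding_adjoint₁ (h : IsQCommutingContractivePair q T₁ T₂) (x : H) :
    douglasEmbedding (T₁ ∘L T₂) h.norm_prod (T₁.adjoint x)
      = (douglasModel₁ h).adjoint (douglasEmbedding (T₁ ∘L T₂) h.norm_prod x) := by
  have hO := mulPencil_rotation_adjoint_intertwine (T := T₁ ∘L T₂) (S := T₁.adjoint)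
    (d := toRangeClosure (defect (T₁ ∘L T₂).adjoint)) (O := observability (T₁ ∘L T₂) h.norm_prod)
    (A := (fundamentalPair h).1) (B := (fundamentalPair h).2) (fun _ _ => rfl) h.norm_q
    h.adj_comm₁ (fundamentalPair_defect₁ h) x
  -- On the `𝒬_{T*}` summand the adjoint of the canonical unitary extends the operator that `T₁*`
  -- induces along `Q_{T*}`.
  have hW : uextIncl (asymptoticIsometry (T₁ ∘L T₂) h.norm_prod)
        (toRangeClosure (asymptoticRoot (T₁ ∘L T₂) h.norm_prod) (T₁.adjoint x))
      = (canonicalPair h).1.adjoint (uextIncl (asymptoticIsometry (T₁ ∘L T₂) h.norm_prod)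
        (toRangeClosure (asymptoticRoot (T₁ ∘L T₂) h.norm_prod) x)) :=
    (congrArg (uextIncl (asymptoticIsometry (T₁ ∘L T₂) h.norm_prod))
      (inducedOp_apply (asymptoticRoot_adjoint_le h).1 x).symm).trans
      (IsCanonicalExtension.adjoint_apply (canonicalPair_spec h) _).1.symm
  exact ((douglas_isModelEmbedding h.norm_prod).intertwine hO hW).trans
    (DFunLike.congr_fun (blockDiag_adjoint _ _).symm _)

theorem douglasEmbedding_adjoint₂ (h : IsQCommutingContractivePair q T₁ T₂) (x : H) :
    douglasEmbedding (T₁ ∘L T₂) h.norm_prod (T₂.adjoint x)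
      = (douglasModel₂ h).adjoint (douglasEmbedding (T₁ ∘L T₂) h.norm_prod x) := by
  have hO := rotation_mulPencil_adjoint_intertwine (T := T₁ ∘L T₂) (S := T₂.adjoint)
    (d := toRangeClosure (defect (T₁ ∘L T₂).adjoint)) (O := observability (T₁ ∘L T₂) h.norm_prod)
    (A := (fundamentalPair h).1) (B := (fundamentalPair h).2) (fun _ _ => rfl) h.norm_conj
    h.adj_comm₂ (fundamentalPair_defect₂ h) x
  have hW : uextIncl (asymptoticIsometry (T₁ ∘L T₂) h.norm_prod)
        (toRangeClosure (asymptoticRoot (T₁ ∘L T₂) h.norm_prod) (T₂.adjoint x))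
      = (canonicalPair h).2.adjoint (uextIncl (asymptoticIsometry (T₁ ∘L T₂) h.norm_prod)
        (toRangeClosure (asymptoticRoot (T₁ ∘L T₂) h.norm_prod) x)) :=
    (congrArg (uextIncl (asymptoticIsometry (T₁ ∘L T₂) h.norm_prod))
      (inducedOp_apply (asymptoticRoot_adjoint_le h).2 x).symm).trans
      (IsCanonicalExtension.adjoint_apply (canonicalPair_spec h) _).2.symm
  exact ((douglas_isModelEmbedding h.norm_prod).intertwine hO hW).trans
    (DFunLike.congr_fun (blockDiag_adjoint _ _).symm _)

theorem douglasModel₁_comm (h : IsQCommutingContractivePair q T₁ T₂)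
    (x : DouglasSpace (T₁ ∘L T₂) h.norm_prod) :
    douglasModel₁ h (douglasLift (T₁ ∘L T₂) h.norm_prod x)
      = q • douglasLift (T₁ ∘L T₂) h.norm_prod (douglasModel₁ h x) :=
  blockDiag_scaled_comm
    (mulPencil_rotation_shift (fundamentalPair h).1.adjoint (fundamentalPair h).2 h.norm_q)
    (IsCanonicalExtension.relations h.norm_q (canonicalPair_spec h)).1 x

theorem douglasModel₂_comm (h : IsQCommutingContractivePair q T₁ T₂)
    (x : DouglasSpace (T₁ ∘L T₂) h.norm_prod) :
    douglasModel₂ h (douglasLift (T₁ ∘L T₂) h.norm_prod x)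
      = (starRingEnd ℂ) q • douglasLift (T₁ ∘L T₂) h.norm_prod (douglasModel₂ h x) :=
  blockDiag_scaled_comm
    (rotation_mulPencil_shift (fundamentalPair h).2.adjoint (fundamentalPair h).1 h.norm_conj)
    (IsCanonicalExtension.relations h.norm_q (canonicalPair_spec h)).2.1 x

theorem douglasModel_relation (h : IsQCommutingContractivePair q T₁ T₂) :
    douglasModel₁ h = (starRingEnd ℂ) q •
      ((douglasModel₂ h).adjoint ∘L douglasLift (T₁ ∘L T₂) h.norm_prod) :=
  blockDiag_relation
    (mulPencil_rotation_eq (fundamentalPair h).1 (fundamentalPair h).2 h.norm_q h.norm_conj)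
    (IsCanonicalExtension.relations h.norm_q (canonicalPair_spec h)).2.2

end Douglas

end QComm

end

/-! ### Identification of an arbitrary pseudo lift with the Douglas model. -/

theorem mainTheorem7 {H K : Type*}
    [NormedAddCommGroup H] [InnerProductSpace ℂ H] [CompleteSpace H]
    [NormedAddCommGroup K] [InnerProductSpace ℂ K] [CompleteSpace K]
    (q : ℂ) (T₁ T₂ : H →L[ℂ] H) (h : QComm.IsQCommutingContractivePair q T₁ T₂)
    (P : H →ₗᵢ[ℂ] K) (W₁ W₂ W : K →L[ℂ] K) (hL : QComm.IsPseudoQLift q T₁ T₂ P W₁ W₂ W) :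
    QComm.IsPseudoQLift q T₁ T₂
        (QComm.douglasEmbedding (T₁ ∘L T₂) h.norm_prod)
        (QComm.douglasModel₁ h) (QComm.douglasModel₂ h)
        (QComm.douglasLift (T₁ ∘L T₂) h.norm_prod) ∧
      QComm.LiftsUnitarilyEquivalent P W₁ W₂ W
        (QComm.douglasEmbedding (T₁ ∘L T₂) h.norm_prod)
        (QComm.douglasModel₁ h) (QComm.douglasModel₂ h)
        (QComm.douglasLift (T₁ ∘L T₂) h.norm_prod) := by
  have hm := (QComm.douglas_isModelEmbedding h.norm_prod).isMinimalIsometricLift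
  obtain ⟨τ, hτP, hτW⟩ := hL.isMinimalIsometricLift.exists_equiv hm
  have hc := hL.conj τ hτP hτW hm.minimal
  -- Only algebraic relations of the model pair are needed here; its contractivity arrives with the
  -- rewrite of `hc`, from the conjugated contractions.
  obtain ⟨e1, e2⟩ := hc.eq_of_relations h.norm_q (QComm.douglasModel₁_comm h)
    (QComm.douglasModel₂_comm h) (QComm.douglasModel_relation h)
    (QComm.douglasEmbedding_adjoint₁ h) (QComm.douglasEmbedding_adjoint₂ h)
  rw [e1, e2] at hc
  refine ⟨hc, τ, hτP, fun x => ?_, fun x => ?_, hτW⟩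
  · rw [← e1, QComm.conjOp_apply, τ.symm_apply_apply]
  · rw [← e2, QComm.conjOp_apply, τ.symm_apply_apply]
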